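/- Let $B=\mathbb Q[x_1,x_2,\dots]$, and let $$\Gamma(z)=\exp\Big(\sum_{i\ge1}x_iz^i\Big)\exp\Big(-\sum_{i\ge1}\frac1{iz^i}\frac{\partial}{\partial x_i}\Big),\qquad \Gamma^*(z)=\exp\Big(-\sum_{i\ge1}x_iz^i\Big)\exp\Big(\sum_{i\ge1}\frac1{iz^i}\frac{\partial}{\partial x_i}\Big)$$ be the bosonic vertex operators $B\to B((z))$. Let $\mathrm{Res}_z$ denote the coefficient of $z^{-1}$. Define $e_n\in B$ by $1-e_1z+e_2z^2-\cdots=\exp(-\sum_{i\ge1}x_iz^i)$, so that $B=\mathbb Q[e_1,e_2,\dots]$. For $r\ge0$ let $B_{r}\otimes\mathbb Q=\mathbb Q[e_1,\dots,e_r]\subseteq B$, put $E_r(z)=1-e_1z+\cdots+(-1)^re_rz^r$ and $\sum_{n\ge 0}h_nz^n=1/E_r(z)$, with $h_n=0$ for $n<0$. For a partition $\lambda=(\lambda_1\ge\cdots\ge\lambda_r\ge0)$ put $\Delta_\lambda(H_r)=\det(h_{\lambda_j-j+i})_{1\le i,j\le r}$; these form a $\mathbb Q$-basis of $B_r\otimes\mathbb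 Q$. Let $M$ be the $\mathbb Q$-vector space with basis $b_0,b_1,\dots$, and let $\phi_r:B_r\otimes\mathbb Q\to\bigwedge^rM$ be the linear map with $\phi_r(\Delta_\lambda(H_r))=b_{\lambda_r}\wedge b_{1+\lambda_{r-1}}\wedge\cdots\wedge b_{r-1+\lambda_1}$. Let $\mathcal G_r\otimes\mathbb Q\subseteq\bigwedge^rM$ be the Grassmann cone of all decomposable tensors $m_1\wedge\cdots\wedge m_r$ with $m_1,\dots,m_r\in M$. One says that $\tau\in B$ corresponds to an element of $\mathcal G_\infty\otimes\mathbb Q$ if there is $r\ge0$ such that, for all $s\ge r$, $\tau\in B_s\otimes\mathbb Q$ and $\phi_s(\tau)\in\mathcal G_s\otimes\mathbb Q$. Then a polynomial $\tau\in B$ corresponds to an element of $\mathcal G_\infty\otimes\mathbb Q$ if and only if $$\mathrm{Res}_z\,\Gamma^*(z)\tau\otimes\Gamma(z)\tau=0\quad\text{in } B\otimes_{\mathbb Q}B .$$ -/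

import Mathlib

namespace KP

open scoped ExteriorAlgebra TensorProduct

/-! ### Exponentials of formal power series -/

/-- `exp f = ∑_k f ^ k / k!` for a formal power series `f` without constant term, over a (possibly
non-commutative) `ℚ`-algebra. Since `f ^ k` is divisible by the `k`-th power of the variable, only
the terms with `k ≤ n` contribute to the `n`-th coefficient. -/
noncomputable def formalExp {R : Type*} [Ring R] [Algebra ℚ R] (f : PowerSeries R) :
    PowerSeries R :=
  PowerSeries.mk fun n => ∑ k ∈ Finset.range (n + 1),
    ((k.factorial : ℚ)⁻¹) • PowerSeries.coeff n (f ^ k)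

/-! ### The ring `B = ℚ[x₁, x₂, …]` and the vertex operators -/

/-- `B = ℚ[x₁, x₂, …]`; the variable `x_{i+1}` is `MvPolynomial.X i`. -/
abbrev B : Type := MvPolynomial ℕ ℚ

/-- `∑_{i ≥ 1} x_i z ^ i`. -/
noncomputable def xSeries : PowerSeries B :=
  PowerSeries.mk fun n => if n = 0 then 0 else MvPolynomial.X (n - 1)

/-- `∑_{i ≥ 1} (1 / i) (∂ / ∂x_i) w ^ i`, a power series in `w = z⁻¹` whose coefficients are
endomorphisms of `B`. -/
noncomputable def dSeries : PowerSeries (Module.End ℚ B) :=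
  PowerSeries.mk fun n => if n = 0 then 0 else
    ((n : ℚ)⁻¹) • (MvPolynomial.pderiv (R := ℚ) (n - 1)).toLinearMap

/-- The weight for which `x_i` has weight `i`. -/
def wt : ℕ → ℕ := fun i => i + 1

/-- `φ` lowers the weight by exactly `n`. -/
def Lowers (n : ℕ) (φ : Module.End ℚ B) : Prop :=
  ∀ (m : ℕ) (p : B), MvPolynomial.IsWeightedHomogeneous wt p m →
    (n ≤ m → MvPolynomial.IsWeightedHomogeneous wt (φ p) (m - n)) ∧ (m < n → φ p = 0)

theorem Lowers.zero (n : ℕ) : Lowers n 0 := fun _ _ _ =>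
  ⟨fun _ => MvPolynomial.isWeightedHomogeneous_zero ℚ wt _, fun _ => rfl⟩

theorem Lowers.one : Lowers 0 1 := fun m p hp =>
  ⟨fun _ => by simpa using hp, fun h => absurd h (Nat.not_lt_zero m)⟩

theorem Lowers.add {n : ℕ} {φ ψ : Module.End ℚ B} (hφ : Lowers n φ) (hψ : Lowers n ψ) :
    Lowers n (φ + ψ) := fun m p hp =>
  ⟨fun h => by
    simpa using (MvPolynomial.weightedHomogeneousSubmodule ℚ wt (m - n)).add_mem
      ((hφ m p hp).1 h) ((hψ m p hp).1 h),
   fun h => by simp [(hφ m p hp).2 h, (hψ m p hp).2 h]⟩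

theorem Lowers.smul {n : ℕ} {φ : Module.End ℚ B} (c : ℚ) (hφ : Lowers n φ) :
    Lowers n (c • φ) := fun m p hp =>
  ⟨fun h => by
    simpa using (MvPolynomial.weightedHomogeneousSubmodule ℚ wt (m - n)).smul_mem c
      ((hφ m p hp).1 h),
   fun h => by simp [(hφ m p hp).2 h]⟩

theorem Lowers.sum {ι : Type*} {n : ℕ} (s : Finset ι) (f : ι → Module.End ℚ B)
    (h : ∀ i ∈ s, Lowers n (f i)) : Lowers n (∑ i ∈ s, f i) :=
  Finset.sum_induction f (Lowers n) (fun _ _ => Lowers.add) (Lowers.zero n) h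

theorem Lowers.mul {n k : ℕ} {φ ψ : Module.End ℚ B} (hφ : Lowers n φ) (hψ : Lowers k ψ) :
    Lowers (n + k) (φ * ψ) := by
  intro m p hp
  rcases lt_or_ge m k with hk | hk
  · refine ⟨fun h => by omega, fun _ => ?_⟩
    simp [(hψ m p hp).2 hk]
  · have h1 := (hψ m p hp).1 hk
    refine ⟨fun h => ?_, fun h => ?_⟩
    · have := (hφ _ _ h1).1 (by omega)
      rwa [show m - k - n = m - (n + k) by omega] at this
    · exact (hφ _ _ h1).2 (by omega)

theorem Lowers.pderiv (i : ℕ) :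
    Lowers (i + 1) (MvPolynomial.pderiv (R := ℚ) i).toLinearMap := by
  intro m p hp
  have key : ∀ s ∈ p.support,
      (i + 1 ≤ m → MvPolynomial.IsWeightedHomogeneous wt
        (MvPolynomial.pderiv i (MvPolynomial.monomial s (p.coeff s))) (m - (i + 1))) ∧
      (m < i + 1 → MvPolynomial.pderiv i (MvPolynomial.monomial s (p.coeff s)) = 0) := by
    intro s hs
    have hw : Finsupp.weight wt s = m := hp (by simpa using hs)
    rw [MvPolynomial.pderiv_monomial]
    by_cases hsi : s i = 0
    · simp [hsi, MvPolynomial.isWeightedHomogeneous_zero]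
    · have hle : Finsupp.single i 1 ≤ s := by
        simpa [Finsupp.single_le_iff] using Nat.one_le_iff_ne_zero.2 hsi
      have h2 : Finsupp.weight wt (s - Finsupp.single i 1) + (i + 1) = m := by
        rw [← hw]
        conv_rhs => rw [← tsub_add_cancel_of_le hle]
        rw [map_add]
        simp [Finsupp.weight_apply, wt]
      refine ⟨fun _ => MvPolynomial.isWeightedHomogeneous_monomial _ _ _ (by omega),
        fun h => by omega⟩
  have hsum : (MvPolynomial.pderiv (R := ℚ) i) p =
      ∑ s ∈ p.support, MvPolynomial.pderiv i (MvPolynomial.monomial s (p.coeff s)) := by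
    conv_lhs => rw [p.as_sum]
    rw [map_sum]
  constructor
  · intro h
    change MvPolynomial.IsWeightedHomogeneous wt ((MvPolynomial.pderiv (R := ℚ) i) p) _
    rw [hsum]
    exact (MvPolynomial.weightedHomogeneousSubmodule ℚ wt (m - (i + 1))).sum_mem
      fun s hs => (key s hs).1 h
  · intro h
    change (MvPolynomial.pderiv (R := ℚ) i) p = 0
    rw [hsum]
    exact Finset.sum_eq_zero fun s hs => (key s hs).2 h

theorem lowers_pow {f : PowerSeries (Module.End ℚ B)}
    (hf : ∀ n, Lowers n (PowerSeries.coeff n f)) (k : ℕ) :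
    ∀ n, Lowers n (PowerSeries.coeff n (f ^ k)) := by
  induction k with
  | zero =>
    intro n
    rw [pow_zero, PowerSeries.coeff_one]
    split_ifs with h
    · subst h; exact Lowers.one
    · exact Lowers.zero n
  | succ k ih =>
    intro n
    rw [pow_succ, PowerSeries.coeff_mul]
    refine Lowers.sum _ _ fun p hp => ?_
    rw [← Finset.HasAntidiagonal.mem_antidiagonal.1 hp]
    exact (ih _).mul (hf _)

theorem lowers_dSeries (n : ℕ) : Lowers n (PowerSeries.coeff n dSeries) := by
  rw [dSeries, PowerSeries.coeff_mk]
  split_ifs with h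
  · exact Lowers.zero n
  · have := (Lowers.pderiv (n - 1)).smul ((n : ℚ)⁻¹)
    rwa [Nat.sub_add_cancel (Nat.one_le_iff_ne_zero.2 h)] at this

theorem lowers_exp (c : ℚ) (n : ℕ) :
    Lowers n (PowerSeries.coeff n (formalExp (c • dSeries))) := by
  rw [formalExp, PowerSeries.coeff_mk]
  refine Lowers.sum _ _ fun k _ => Lowers.smul _ (lowers_pow (fun m => ?_) k n)
  exact (lowers_dSeries m).smul c

theorem exp_dSeries_eventually_zero (c : ℚ) (τ : B) (n : ℕ)
    (hn : MvPolynomial.weightedTotalDegree wt τ < n) :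
    PowerSeries.coeff n (formalExp (c • dSeries)) τ = 0 := by
  conv_lhs => rw [τ.as_sum]
  rw [map_sum]
  refine Finset.sum_eq_zero fun s hs => ?_
  exact (lowers_exp c n _ _ (MvPolynomial.isWeightedHomogeneous_monomial wt s _ rfl)).2
    ((MvPolynomial.le_weightedTotalDegree wt hs).trans_lt hn)

/-- `exp (c ∑_{i ≥ 1} (1 / (i z ^ i)) ∂ / ∂x_i) τ`, as a Laurent series in `z` (in fact a polynomial
in `z⁻¹`): the coefficient of `z ^ (-n)` is the `n`-th coefficient of the exponential in
`w = z⁻¹`, applied to `τ`. -/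
noncomputable def expD (c : ℚ) (τ : B) : LaurentSeries B :=
  HahnSeries.ofSuppBddBelow
    (fun k : ℤ => if k ≤ 0 then PowerSeries.coeff (-k).toNat (formalExp (c • dSeries)) τ else 0)
    ⟨-((MvPolynomial.weightedTotalDegree wt τ : ℕ) : ℤ), by
      intro k hk
      by_contra hlt
      apply hk
      have : k ≤ 0 := by omega
      simp only [this, if_true]
      exact exp_dSeries_eventually_zero c τ _ (by omega)⟩

/-- The vertex operator
`Γ(z) = exp (∑_{i ≥ 1} x_i z ^ i) exp (- ∑_{i ≥ 1} (1 / (i z ^ i)) ∂ / ∂x_i) : B → B((z))`. -/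
noncomputable def Gam (τ : B) : LaurentSeries B :=
  HahnSeries.ofPowerSeries ℤ B (formalExp xSeries) * expD (-1) τ

/-- The vertex operator
`Γ*(z) = exp (- ∑_{i ≥ 1} x_i z ^ i) exp (∑_{i ≥ 1} (1 / (i z ^ i)) ∂ / ∂x_i) : B → B((z))`. -/
noncomputable def GamStar (τ : B) : LaurentSeries B :=
  HahnSeries.ofPowerSeries ℤ B (formalExp (-xSeries)) * expD 1 τ

/-- For `f, g ∈ B((z))`, the series `f ⊗ g ∈ (B ⊗ B)((z))`. -/
noncomputable def laurentTensor (f g : LaurentSeries B) : LaurentSeries (B ⊗[ℚ] B) :=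
  f.map (Algebra.TensorProduct.includeLeft : B →ₐ[ℚ] B ⊗[ℚ] B) *
    g.map (Algebra.TensorProduct.includeRight : B →ₐ[ℚ] B ⊗[ℚ] B)

/-- `Res_z`: the coefficient of `z⁻¹`. -/
noncomputable def residue {R : Type*} [Zero R] (f : LaurentSeries R) : R := f.coeff (-1)

/-- The Hirota bilinear form of the KP hierarchy: `Res_z Γ*(z)τ ⊗ Γ(z)τ = 0` in `B ⊗ B`. -/
def HirotaKP (τ : B) : Prop := residue (laurentTensor (GamStar τ) (Gam τ)) = 0

/-! ### The rings `B_r ⊗ ℚ = ℚ[e₁, …, e_r]` and Schur determinants -/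

/-- `B_r ⊗ ℚ = ℚ[e₁, …, e_r]`; the variable `e_{i+1}` is `MvPolynomial.X i`. -/
abbrev Br (r : ℕ) : Type := MvPolynomial (Fin r) ℚ

/-- `E_r(z) = 1 - e₁ z + ⋯ + (-1) ^ r e_r z ^ r`. -/
noncomputable def E (r : ℕ) : PowerSeries (Br r) :=
  1 + ∑ i : Fin r, PowerSeries.C ((-1) ^ ((i : ℕ) + 1) * MvPolynomial.X i) *
    PowerSeries.X ^ ((i : ℕ) + 1)

/-- `1 / E_r(z)`. -/
noncomputable def H (r : ℕ) : PowerSeries (Br r) := PowerSeries.invOfUnit (E r) 1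

/-- `h_n ∈ B_r`: the coefficient of `z ^ n` in `1 / E_r(z)`, and `0` for `n < 0`. -/
noncomputable def h (r : ℕ) (n : ℤ) : Br r :=
  if 0 ≤ n then PowerSeries.coeff n.toNat (H r) else 0

/-- The partitions of length at most `r`, written as `λ₁ ≥ ⋯ ≥ λ_r ≥ 0`. -/
abbrev Par (r : ℕ) : Type := {l : Fin r → ℕ // Antitone l}

/-- The Schur determinant `Δ_λ(H_r) = det (h_{λ_j - j + i})_{1 ≤ i, j ≤ r}`. -/
noncomputable def schurDet {r : ℕ} (l : Par r) : Br r :=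
  Matrix.det (Matrix.of fun i j : Fin r => h r ((l.1 j : ℤ) - (j : ℤ) + (i : ℤ)))

/-! ### The Schur determinants form a basis of `B_r ⊗ ℚ` -/

/-- The exponents `k + λ_{r-k}`, for `0 ≤ k < r`. -/
def expo {r : ℕ} (l : Par r) (k : Fin r) : ℕ := (k : ℕ) + l.1 (Fin.rev k)

theorem expo_strictMono {r : ℕ} (l : Par r) : StrictMono (expo l) := by
  intro a b hab
  have h1 := l.2 (Fin.rev_le_rev.2 hab.le)
  have h2 : (a : ℕ) < b := hab
  simp only [expo]
  omega

theorem expo_injective {r : ℕ} {l m : Par r} (hlm : expo l = expo m) : l = m := by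
  apply Subtype.ext
  funext i
  have := congrFun hlm (Fin.rev i)
  simpa [expo] using this

theorem exists_expo {r : ℕ} (n : Fin r → ℕ) (hn : StrictMono n) : ∃ l : Par r, expo l = n := by
  have hmono : ∀ a b : Fin r, a ≤ b → n a + ((b : ℕ) - a) ≤ n b := by
    intro a b hab
    obtain ⟨d, hd⟩ := Nat.exists_eq_add_of_le (show (a : ℕ) ≤ b from hab)
    induction d generalizing b with
    | zero =>
      have : a = b := Fin.ext (by omega)
      subst this; simp
    | succ d ih =>
      have hb := b.2
      let c : Fin r := ⟨a + d, by omega⟩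
      have h1 := ih c (Fin.le_def.2 (by simp [c])) rfl
      have h2 : n c < n b := hn (Fin.lt_def.2 (by simp only [c]; omega))
      simp only [c] at h1 h2
      omega
  have hge : ∀ a : Fin r, (a : ℕ) ≤ n a := by
    intro a
    have ha := a.2
    have := hmono ⟨0, by omega⟩ a (Fin.le_def.2 (Nat.zero_le _))
    simp only at this
    omega
  refine ⟨⟨fun i => n (Fin.rev i) - (Fin.rev i : ℕ), ?_⟩, ?_⟩
  · intro i j hij
    have h1 := hmono _ _ (Fin.rev_le_rev.2 hij)
    have h2 : (Fin.rev j : ℕ) ≤ Fin.rev i := Fin.rev_le_rev.2 hij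
    have h3 := hge (Fin.rev j)
    simp only
    omega
  · funext k
    have := hge k
    simp only [expo, Fin.rev_rev]
    omega

/-- `det (h_{n_a - b})`, for an arbitrary sequence `n`. -/
noncomputable def hDet {r : ℕ} (n : Fin r → ℕ) : Br r :=
  Matrix.det (Matrix.of fun a b : Fin r => h r ((n a : ℤ) - (b : ℤ)))

theorem schurDet_eq_hDet {r : ℕ} (l : Par r) : schurDet l = hDet (expo l) := by
  rw [schurDet, hDet, ← Matrix.det_transpose, ← Matrix.det_submatrix_equiv_self Fin.revPerm]
  congr 1
  ext1 a b
  simp only [Matrix.submatrix_apply, Matrix.transpose_apply, Matrix.of_apply, Fin.revPerm_apply,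
    expo, Fin.val_rev]
  congr 1
  have := a.2
  have := b.2
  push_cast
  omega

/-- `ℚ[e₁, …, e_r] → ℚ[x₁, …, x_r]`, sending `e_i` to the elementary symmetric polynomial. -/
noncomputable def toSymm (r : ℕ) : Br r →ₐ[ℚ] Br r :=
  MvPolynomial.aeval fun i : Fin r => MvPolynomial.esymm (Fin r) ℚ ((i : ℕ) + 1)

theorem toSymm_injective (r : ℕ) : Function.Injective (toSymm r) := by
  intro p q hpq
  have h1 := MvPolynomial.esymmAlgHom_fin_injective (R := ℚ) (n := r) (m := r) le_rfl
  apply h1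
  apply Subtype.ext
  rw [MvPolynomial.esymmAlgHom_apply, MvPolynomial.esymmAlgHom_apply]
  exact hpq

theorem prod_one_add_eq {r : ℕ} :
    PowerSeries.map (toSymm r : Br r →+* Br r) (E r) =
      ∏ i : Fin r, (1 - PowerSeries.C (MvPolynomial.X i : Br r) * PowerSeries.X) := by
  simp_rw [sub_eq_add_neg]
  rw [Finset.prod_one_add, Finset.sum_powerset]
  rw [Finset.card_univ, Fintype.card_fin, Finset.sum_range_succ']
  rw [add_comm]
  simp only [E, map_add, map_one, map_sum, map_mul, map_pow, PowerSeries.map_C, PowerSeries.map_X,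
    map_neg]
  congr 1
  · simp
  · rw [← Fin.sum_univ_eq_sum_range
      (fun k => ∑ t ∈ Finset.powersetCard (k + 1) (Finset.univ : Finset (Fin r)),
        ∏ i ∈ t, -(PowerSeries.C (MvPolynomial.X i : Br r) * PowerSeries.X))]
    refine Finset.sum_congr rfl fun i _ => ?_
    have : (toSymm r : Br r →+* Br r) (MvPolynomial.X i) =
        ∑ t ∈ Finset.powersetCard ((i : ℕ) + 1) (Finset.univ : Finset (Fin r)),
          ∏ j ∈ t, MvPolynomial.X j := by
      simp [toSymm, MvPolynomial.esymm]
    rw [this, map_sum, Finset.mul_sum, Finset.sum_mul]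
    refine Finset.sum_congr rfl fun t ht => ?_
    rw [Finset.prod_neg, Finset.prod_mul_distrib, Finset.prod_const,
      (Finset.mem_powersetCard.1 ht).2, map_prod]
    ring

theorem E_mul_H (r : ℕ) : E r * H r = 1 := by
  apply PowerSeries.mul_invOfUnit
  simp [E]

/-- The `b`-th coefficient of `∏_{i ≠ j} (1 - x_i z)`. -/
noncomputable def cofac (r : ℕ) (b j : Fin r) : Br r :=
  PowerSeries.coeff (b : ℕ) (∏ i ∈ Finset.univ.erase j,
    (1 - PowerSeries.C (MvPolynomial.X i : Br r) * PowerSeries.X))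

theorem coeff_cofac_eq_zero {r : ℕ} (j : Fin r) (b : ℕ) (hb : r ≤ b) :
    PowerSeries.coeff b (∏ i ∈ Finset.univ.erase j,
      (1 - PowerSeries.C (MvPolynomial.X i : Br r) * PowerSeries.X)) = 0 := by
  have h1 : (∏ i ∈ Finset.univ.erase j,
      (1 - PowerSeries.C (MvPolynomial.X i : Br r) * PowerSeries.X)) =
      ((∏ i ∈ Finset.univ.erase j,
      (1 - Polynomial.C (MvPolynomial.X i : Br r) * Polynomial.X) : Polynomial (Br r)) :
        PowerSeries (Br r)) := by
    rw [← Polynomial.coeToPowerSeries.ringHom_apply, map_prod]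
    refine Finset.prod_congr rfl fun i _ => ?_
    simp [Polynomial.coeToPowerSeries.ringHom_apply]
  rw [h1, Polynomial.coeff_coe]
  apply Polynomial.coeff_eq_zero_of_natDegree_lt
  refine (Polynomial.natDegree_prod_le _ _).trans_lt ?_
  refine (Finset.sum_le_card_nsmul _ _ 1 fun i _ => ?_).trans_lt ?_
  · refine (Polynomial.natDegree_sub_le _ _).trans ?_
    simp
  · have := j.2
    simp
    omega

theorem pow_eq_sum {r : ℕ} (n : ℕ) (j : Fin r) :
    (MvPolynomial.X j : Br r) ^ n =
      ∑ b : Fin r, toSymm r (h r ((n : ℤ) - (b : ℤ))) * cofac r b j := by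
  set Q := ∏ i ∈ Finset.univ.erase j,
    (1 - PowerSeries.C (MvPolynomial.X i : Br r) * PowerSeries.X) with hQ
  set T := PowerSeries.map (toSymm r : Br r →+* Br r) (H r) with hT
  set L := 1 - PowerSeries.C (MvPolynomial.X j : Br r) * PowerSeries.X with hL
  have h1 : (L * Q) * T = 1 := by
    rw [hL, hQ, Finset.mul_prod_erase Finset.univ
      (fun i => 1 - PowerSeries.C (MvPolynomial.X i : Br r) * PowerSeries.X) (Finset.mem_univ j),
      ← prod_one_add_eq, hT, ← map_mul, E_mul_H, map_one]
  have h2 : PowerSeries.mk (fun n => (MvPolynomial.X j : Br r) ^ n) * L = 1 := by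
    ext1 m
    rw [hL, mul_sub, mul_one, map_sub, ← mul_assoc, PowerSeries.coeff_mk]
    cases m with
    | zero => simp
    | succ m =>
      rw [PowerSeries.coeff_succ_mul_X, PowerSeries.coeff_mul_C, PowerSeries.coeff_mk,
        PowerSeries.coeff_one]
      simp [pow_succ]
  have h3 : PowerSeries.mk (fun n => (MvPolynomial.X j : Br r) ^ n) = Q * T := by
    calc _ = PowerSeries.mk (fun n => (MvPolynomial.X j : Br r) ^ n) * ((L * Q) * T) := by
          rw [h1, mul_one]
      _ = (PowerSeries.mk (fun n => (MvPolynomial.X j : Br r) ^ n) * L) * (Q * T) := by ring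
      _ = _ := by rw [h2, one_mul]
  have h4 := congrArg (PowerSeries.coeff n) h3
  rw [PowerSeries.coeff_mk, PowerSeries.coeff_mul] at h4
  rw [h4, Finset.Nat.sum_antidiagonal_eq_sum_range_succ_mk]
  change _ = ∑ b : Fin r, toSymm r (h r ((n : ℤ) - ((b : ℕ) : ℤ))) * PowerSeries.coeff (b : ℕ) Q
  rw [Fin.sum_univ_eq_sum_range (fun b => toSymm r (h r ((n : ℤ) - (b : ℤ))) *
    PowerSeries.coeff b Q)]
  have hterm : ∀ b, b ≤ n → toSymm r (h r ((n : ℤ) - (b : ℤ))) =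
      PowerSeries.coeff (n - b) T := by
    intro b hb
    rw [h, if_pos (by omega), hT, PowerSeries.coeff_map]
    rw [show ((n : ℤ) - (b : ℤ)).toNat = n - b by omega]
    rfl
  have hA : ∑ k ∈ Finset.range n.succ, PowerSeries.coeff k Q * PowerSeries.coeff (n - k) T =
      ∑ k ∈ Finset.range (max n.succ r), toSymm r (h r ((n : ℤ) - (k : ℤ))) *
        PowerSeries.coeff k Q := by
    rw [← Finset.sum_subset (Finset.range_subset_range.2 (le_max_left n.succ r))]
    · refine Finset.sum_congr rfl fun k hk => ?_
      rw [hterm k (by simpa [Nat.lt_succ_iff] using hk), mul_comm]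
    · intro k _ hk
      rw [h, if_neg, map_zero, zero_mul]
      simp at hk
      omega
  rw [hA]
  symm
  apply Finset.sum_subset (Finset.range_subset_range.2 (le_max_right n.succ r))
  intro k _ hk
  rw [hQ, coeff_cofac_eq_zero j k (by simpa using hk), mul_zero]

/-- The alternant `det (x_j ^ {n_a})`. -/
noncomputable def alt {r : ℕ} (n : Fin r → ℕ) : Br r :=
  Matrix.det (Matrix.of fun a j : Fin r => (MvPolynomial.X j : Br r) ^ n a)

theorem toSymm_hDet {r : ℕ} (n : Fin r → ℕ) :
    toSymm r (hDet n) * (Matrix.of (cofac r)).det = alt n := by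
  rw [hDet, AlgHom.map_det, ← Matrix.det_mul, alt]
  congr 1
  ext1 a j
  simp only [Matrix.mul_apply, Matrix.of_apply, AlgHom.mapMatrix_apply, Matrix.map_apply]
  exact (pow_eq_sum (n a) j).symm

theorem det_cofac_ne_zero (r : ℕ) : (Matrix.of (cofac r)).det ≠ 0 := by
  intro h0
  have h1 := toSymm_hDet (r := r) (fun a => (a : ℕ))
  rw [h0, mul_zero] at h1
  have h2 : alt (r := r) (fun a => (a : ℕ)) =
      (Matrix.vandermonde (fun i : Fin r => (MvPolynomial.X i : Br r))).det := by
    rw [alt, ← Matrix.det_transpose]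
    rfl
  rw [h2] at h1
  exact Matrix.det_vandermonde_ne_zero_iff.2 (MvPolynomial.X_injective) h1.symm

theorem alt_apply {r : ℕ} (n : Fin r → ℕ) :
    alt n = ∑ σ : Equiv.Perm (Fin r), (Equiv.Perm.sign σ : ℤ) •
      ∏ a, (MvPolynomial.X (σ a) : Br r) ^ n a := by
  rw [alt, ← Matrix.det_transpose, Matrix.det_apply]
  rfl

theorem esymm_mul_alt {r : ℕ} (k : ℕ) (n : Fin r → ℕ) :
    MvPolynomial.esymm (Fin r) ℚ k * alt n =
      ∑ t ∈ Finset.powersetCard k (Finset.univ : Finset (Fin r)),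
        alt (fun a => n a + if a ∈ t then 1 else 0) := by
  simp_rw [alt_apply]
  rw [Finset.sum_comm, Finset.mul_sum]
  refine Finset.sum_congr rfl fun σ _ => ?_
  have hσ : MvPolynomial.esymm (Fin r) ℚ k =
      ∑ t ∈ Finset.powersetCard k (Finset.univ : Finset (Fin r)),
        ∏ a ∈ t, MvPolynomial.X (σ a) := by
    rw [← MvPolynomial.rename_esymm (Fin r) ℚ k σ, MvPolynomial.esymm, map_sum]
    simp [map_prod]
  rw [hσ, Finset.sum_mul]
  refine Finset.sum_congr rfl fun t _ => ?_
  rw [mul_smul_comm]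
  congr 1
  simp_rw [pow_add]
  rw [Finset.prod_mul_distrib, mul_comm]
  congr 1
  simp [pow_ite, Finset.prod_ite_mem]

theorem X_mul_hDet {r : ℕ} (i : Fin r) (n : Fin r → ℕ) :
    MvPolynomial.X i * hDet n =
      ∑ t ∈ Finset.powersetCard ((i : ℕ) + 1) (Finset.univ : Finset (Fin r)),
        hDet (fun a => n a + if a ∈ t then 1 else 0) := by
  apply toSymm_injective r
  apply mul_right_cancel₀ (det_cofac_ne_zero r)
  rw [map_mul, mul_assoc, toSymm_hDet, map_sum, Finset.sum_mul]
  simp_rw [toSymm_hDet]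
  rw [← esymm_mul_alt]
  simp [toSymm]

theorem hDet_mem_span {r : ℕ} (n : Fin r → ℕ) :
    hDet n ∈ Submodule.span ℚ (Set.range (schurDet (r := r))) := by
  by_cases hn : Function.Injective n
  · have hs : StrictMono (n ∘ Tuple.sort n) :=
      (Tuple.monotone_sort n).strictMono_of_injective (hn.comp (Tuple.sort n).injective)
    obtain ⟨l, hl⟩ := exists_expo _ hs
    have h1 : schurDet l = (Equiv.Perm.sign (Tuple.sort n) : Br r) * hDet n := by
      rw [schurDet_eq_hDet, hl, hDet, hDet, ← Matrix.det_permute]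
      rfl
    have h2 : hDet n = (Equiv.Perm.sign (Tuple.sort n) : ℤ) • schurDet l := by
      rw [h1, zsmul_eq_mul, ← mul_assoc, ← Int.cast_mul, ← Units.val_mul]
      simp
    rw [h2]
    exact Submodule.smul_of_tower_mem _ _ (Submodule.subset_span ⟨l, rfl⟩)
  · have : hDet n = 0 := by
      simp only [Function.Injective, not_forall] at hn
      obtain ⟨a, b, hab, hne⟩ := hn
      refine Matrix.det_zero_of_row_eq hne ?_
      funext c
      simp [hab]
    rw [this]
    exact Submodule.zero_mem _

theorem hDet_id (r : ℕ) : hDet (r := r) (fun a => (a : ℕ)) = 1 := by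
  rw [hDet, Matrix.det_of_isLowerTriangular]
  · apply Finset.prod_eq_one
    intro a _
    simp [h, H, PowerSeries.coeff_zero_eq_constantCoeff]
  · intro a b hab
    have : (a : ℕ) < b := hab
    simp only [Matrix.of_apply, h]
    rw [if_neg (by omega)]

theorem schurDet_span (r : ℕ) :
    ⊤ ≤ Submodule.span ℚ (Set.range (schurDet (r := r))) := by
  set S := Submodule.span ℚ (Set.range (schurDet (r := r))) with hS
  intro p _
  induction p using MvPolynomial.induction_on with
  | C a =>
    have h1 : (1 : Br r) ∈ S := hDet_id r ▸ hDet_mem_span _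
    have := S.smul_mem a h1
    rwa [MvPolynomial.smul_eq_C_mul, mul_one] at this
  | add p q hp hq => exact S.add_mem (hp trivial) (hq trivial)
  | mul_X p i hp =>
    have hp' := hp trivial
    clear hp
    rw [hS] at hp'
    induction hp' using Submodule.span_induction with
    | mem x hx =>
      obtain ⟨l, rfl⟩ := hx
      rw [schurDet_eq_hDet, mul_comm, X_mul_hDet]
      exact S.sum_mem fun t _ => hDet_mem_span _
    | zero => rw [zero_mul]; exact S.zero_mem
    | add x y _ _ hx hy => rw [add_mul]; exact S.add_mem (hx trivial) (hy trivial)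
    | smul c x _ hx => rw [smul_mul_assoc]; exact S.smul_mem c (hx trivial)

theorem coeff_alt {r : ℕ} (l m : Par r) :
    MvPolynomial.coeff (Finsupp.equivFunOnFinite.symm (expo l)) (alt (expo m)) =
      if m = l then 1 else 0 := by
  have hmon : ∀ σ : Equiv.Perm (Fin r), ∏ a, (MvPolynomial.X (σ a) : Br r) ^ expo m a =
      MvPolynomial.monomial (Finsupp.equivFunOnFinite.symm (expo m ∘ σ.symm)) 1 := by
    intro σ
    rw [MvPolynomial.monomial_eq, map_one, one_mul, Finsupp.prod_fintype _ _ (by simp)]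
    rw [← Equiv.prod_comp σ (fun x => (MvPolynomial.X x : Br r) ^
      (Finsupp.equivFunOnFinite.symm (expo m ∘ σ.symm)) x)]
    simp
  have hσ : ∀ σ : Equiv.Perm (Fin r), expo m ∘ σ.symm = expo l → σ = 1 ∧ m = l := by
    intro σ hσ
    have hrange : Set.range (expo m) = Set.range (expo l) := by
      rw [← hσ, Set.range_comp, σ.symm.surjective.range_eq, Set.image_univ]
    have heq : expo m = expo l :=
      (expo_strictMono m).range_inj (expo_strictMono l) |>.1 hrange
    refine ⟨?_, expo_injective heq⟩
    ext a
    have h1 := congrFun hσ (σ a)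
    rw [← heq] at h1
    simp only [Function.comp_apply, Equiv.symm_apply_apply] at h1
    simpa using congrArg Fin.val ((expo_strictMono m).injective h1).symm
  rw [alt_apply, MvPolynomial.coeff_sum]
  simp_rw [hmon, MvPolynomial.coeff_smul, MvPolynomial.coeff_monomial]
  split_ifs with hml
  · subst hml
    rw [Finset.sum_eq_single 1]
    · rw [if_pos (by rfl)]
      simp
    · intro σ _ hne
      rw [if_neg, smul_zero]
      intro he
      exact hne (hσ σ (Finsupp.equivFunOnFinite.symm.injective he)).1
    · simp
  · refine Finset.sum_eq_zero fun σ _ => ?_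
    rw [if_neg, smul_zero]
    intro he
    exact hml (hσ σ (Finsupp.equivFunOnFinite.symm.injective he)).2

theorem schurDet_linearIndependent (r : ℕ) : LinearIndependent ℚ (schurDet (r := r)) := by
  have halt : LinearIndependent ℚ (fun l : Par r => alt (expo l)) := by
    rw [linearIndependent_iff']
    intro s g hg l hl
    have := congrArg (MvPolynomial.coeff (Finsupp.equivFunOnFinite.symm (expo l))) hg
    simpa [MvPolynomial.coeff_sum, coeff_alt, hl] using this
  let f : Br r →ₗ[ℚ] Br r :=
    (LinearMap.mulRight ℚ (Matrix.of (cofac r)).det).comp (toSymm r).toLinearMap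
  have hf : (f ∘ schurDet (r := r)) = fun l : Par r => alt (expo l) := by
    funext l
    simp only [f, Function.comp_apply, LinearMap.comp_apply, LinearMap.mulRight_apply,
      AlgHom.toLinearMap_apply]
    rw [schurDet_eq_hDet, toSymm_hDet]
  exact LinearIndependent.of_comp f (hf ▸ halt)

/-- The basis `(Δ_λ(H_r))`, `λ` of length at most `r`, of `B_r ⊗ ℚ`. -/
noncomputable def schurBasis (r : ℕ) : Module.Basis (Par r) ℚ (Br r) :=
  Module.Basis.mk (schurDet_linearIndependent r) (schurDet_span r)

/-! ### Exterior powers and Grassmann cones -/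

/-- `M₀ ⊗ ℚ`, the rational vector space with basis `b₀, b₁, …`. -/
abbrev M : Type := ℕ →₀ ℚ

/-- The basis vector `b_i`. -/
noncomputable def b (i : ℕ) : M := Finsupp.single i 1

/-- `[b]^r_λ = b_{λ_r} ∧ b_{1 + λ_{r-1}} ∧ ⋯ ∧ b_{r-1+λ_1}`. -/
noncomputable def wedge {r : ℕ} (l : Par r) : ⋀[ℚ]^r M :=
  exteriorPower.ιMulti ℚ r fun k : Fin r => b ((k : ℕ) + l.1 (Fin.rev k))

/-- The linear map `φ_r : B_r ⊗ ℚ → ⋀^r (M₀ ⊗ ℚ)` with `φ_r (Δ_λ(H_r)) = [b]^r_λ`. -/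
noncomputable def phi (r : ℕ) : Br r →ₗ[ℚ] ⋀[ℚ]^r M :=
  (schurBasis r).constr ℚ wedge

theorem phi_schurDet {r : ℕ} (l : Par r) : phi r (schurDet l) = wedge l := by
  have := (schurBasis r).constr_basis ℚ wedge l
  rwa [schurBasis, Module.Basis.mk_apply] at this

/-- The Grassmann cone `𝒢_r ⊗ ℚ` of decomposable tensors `m₁ ∧ ⋯ ∧ m_r` in `⋀^r (M₀ ⊗ ℚ)`. -/
def cone (r : ℕ) : Set (⋀[ℚ]^r M) :=
  Set.range (exteriorPower.ιMulti ℚ r : (Fin r → M) → ⋀[ℚ]^r M)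

/-! ### Polynomials corresponding to elements of the cone `𝒢_∞ ⊗ ℚ` -/

/-- `e_n ∈ B`, defined by `1 - e₁ z + e₂ z ^ 2 - ⋯ = exp (- ∑_{i ≥ 1} x_i z ^ i)`. -/
noncomputable def eInf (n : ℕ) : B :=
  (-1) ^ n * PowerSeries.coeff n (formalExp (-xSeries))

/-- The inclusion `B_r ⊗ ℚ = ℚ[e₁, …, e_r] ⊆ ℚ[e₁, e₂, …] = B`. -/
noncomputable def incl (r : ℕ) : Br r →ₐ[ℚ] B :=
  MvPolynomial.aeval fun i : Fin r => eInf ((i : ℕ) + 1)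

/-- `τ` corresponds to an element of `𝒢_∞ ⊗ ℚ`: there is `r` such that for all `s ≥ r` one has
`τ ∈ B_s ⊗ ℚ` and `φ_s (τ) ∈ 𝒢_s ⊗ ℚ`. -/
def CorrespondsToCone (τ : B) : Prop :=
  ∃ r : ℕ, ∀ s ≥ r, ∃ p : Br s, incl s p = τ ∧ phi s p ∈ cone s

end KP

namespace KP

open scoped ExteriorAlgebra TensorProduct

/-! ### Properties of the formal exponential -/

/-! Put `x_i = (∑ y_j ^ i) / i` for finitely many points `y_j`. Then `exp (-∑ x_i z ^ i)` becomes `∏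
(1 - y_j z)` (`map_formalExp_neg_xSeries`), and the exponentials of derivatives in `Γ*` and `Γ`
become translations that add, respectively remove, the point `z⁻¹` (`aeval_coeff_formalExp_dSeries`,
`eval_translate`). By partial fractions the residue, evaluated at a set of points in each tensor
factor, the second set having two more points than the first, is a weighted sum over the second set
(`productMap_residue_Gam`).

Let `A(y)` be `τ(y)` times the Vandermonde determinant of `s` points `y`. Take `y₀` without `y₀ a`
as the first set and `y` together with `y₀ a` as the second. Up to a nonzero factor, the residue is
then the defect in the Plücker exchange relation for `A` (`alternant_exchange`).

On the other side, sending `b_n` to `t ^ n` embeds `⋀^s M` into the polynomials in `s` variables.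
The bialternant formula shows that this embedding, composed with `φ_s`, is multiplication by the
Vandermonde determinant (`altMap_phi`). Hence `φ_s(τ)` is decomposable exactly when `A(y) = det
(f_i(y_j))` for polynomials `f_i` in one variable (`phi_mem_cone_iff`).

Determinants satisfy the exchange relations by Cramer's rule (`det_exchange`), so for decomposable
`φ_s(τ)` the residue vanishes at enough points to be zero (`exists_eq_zero_of_productMap`).
Conversely, an alternating function with the exchange relations at some `y₀` where it is nonzero is
a determinant (`eq_det_of_exchange`), whose entries are polynomials because `A` is one. -/

theorem coeff_pow_of_lt {R : Type*} [Ring R] {f : PowerSeries R}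
    (hf : PowerSeries.constantCoeff f = 0) (k : ℕ) :
    ∀ n, n < k → PowerSeries.coeff n (f ^ k) = 0 := by
  induction k with
  | zero => intro n hn; omega
  | succ k ih =>
    intro n hn
    rw [pow_succ, PowerSeries.coeff_mul]
    refine Finset.sum_eq_zero fun p hp => ?_
    have hp' := Finset.HasAntidiagonal.mem_antidiagonal.1 hp
    rcases Nat.eq_zero_or_pos p.2 with h0 | h0
    · rw [h0, PowerSeries.coeff_zero_eq_constantCoeff_apply, hf, mul_zero]
    · rw [ih p.1 (by omega), zero_mul]

/-- Powers beyond the `n`-th contribute nothing, so every longer truncation is equally good; this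
lets coefficients of different orders share one summation range. -/
theorem coeff_formalExp {R : Type*} [Ring R] [Algebra ℚ R] {f : PowerSeries R}
    (hf : PowerSeries.constantCoeff f = 0) {n N : ℕ} (hn : n < N) :
    PowerSeries.coeff n (formalExp f) =
      ∑ k ∈ Finset.range N, ((k.factorial : ℚ)⁻¹) • PowerSeries.coeff n (f ^ k) := by
  rw [formalExp, PowerSeries.coeff_mk]
  apply Finset.sum_subset (Finset.range_subset_range.2 hn)
  intro k _ hk
  rw [coeff_pow_of_lt hf k n (by simp at hk; omega), smul_zero]

theorem constantCoeff_formalExp {R : Type*} [Ring R] [Algebra ℚ R] (f : PowerSeries R) :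
    PowerSeries.constantCoeff (formalExp f) = 1 := by
  rw [← PowerSeries.coeff_zero_eq_constantCoeff_apply]
  simp [formalExp]

theorem map_formalExp {R S : Type*} [Ring R] [Algebra ℚ R] [Ring S] [Algebra ℚ S]
    (φ : R →ₐ[ℚ] S) (f : PowerSeries R) :
    PowerSeries.map (φ : R →+* S) (formalExp f) =
      formalExp (PowerSeries.map (φ : R →+* S) f) := by
  ext1 n
  simp only [formalExp, PowerSeries.coeff_map, PowerSeries.coeff_mk, ← map_pow]
  simp

theorem derivative_formalExp {R : Type*} [CommRing R] [Algebra ℚ R] {f : PowerSeries R}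
    (hf : PowerSeries.constantCoeff f = 0) :
    PowerSeries.derivative R (formalExp f) = formalExp f * PowerSeries.derivative R f := by
  ext1 n
  rw [PowerSeries.coeff_derivative, coeff_formalExp hf (show n + 1 < n + 2 by omega),
    Finset.sum_range_succ', PowerSeries.coeff_mul]
  have h1 : ∀ p ∈ Finset.HasAntidiagonal.antidiagonal n, PowerSeries.coeff p.1 (formalExp f) *
      PowerSeries.coeff p.2 (PowerSeries.derivative R f) =
      ∑ k ∈ Finset.range (n + 1), ((k.factorial : ℚ)⁻¹) • (PowerSeries.coeff p.1 (f ^ k) *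
        PowerSeries.coeff p.2 (PowerSeries.derivative R f)) := by
    intro p hp
    have := Finset.HasAntidiagonal.mem_antidiagonal.1 hp
    rw [coeff_formalExp hf (show p.1 < n + 1 by omega), Finset.sum_mul]
    simp_rw [smul_mul_assoc]
  rw [Finset.sum_congr rfl h1, Finset.sum_comm]
  simp_rw [← Finset.smul_sum, ← PowerSeries.coeff_mul]
  rw [pow_zero, PowerSeries.coeff_one, if_neg (by omega), smul_zero, add_zero, Finset.sum_mul]
  refine Finset.sum_congr rfl fun k _ => ?_
  rw [smul_mul_assoc, ← PowerSeries.coeff_derivative, PowerSeries.derivative_pow,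
    Nat.add_sub_cancel, Nat.factorial_succ]
  have h2 : ((k + 1 : ℕ) : PowerSeries R) * f ^ k * PowerSeries.derivative R f =
      (k + 1) • (f ^ k * PowerSeries.derivative R f) := by
    rw [nsmul_eq_mul, mul_assoc]
  rw [h2, map_nsmul, ← Nat.cast_smul_eq_nsmul ℚ, smul_smul]
  congr 1
  have : ((k : ℚ) + 1) ≠ 0 := by positivity
  push_cast
  field_simp

/-- In `F' = F g` the coefficient of order `n + 1` is determined by the earlier ones, since `n + 1`
is invertible. This identifies exponentials without logarithms. -/
theorem eq_of_derivative_eq_mul {F G g : PowerSeries ℚ}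
    (hF : PowerSeries.derivative ℚ F = F * g) (hG : PowerSeries.derivative ℚ G = G * g)
    (h0 : PowerSeries.constantCoeff F = PowerSeries.constantCoeff G) : F = G := by
  ext n
  induction n using Nat.strong_induction_on with
  | _ n ih =>
    rcases n with _ | n
    · simpa using h0
    · have h1 := congrArg (PowerSeries.coeff n) hF
      have h2 := congrArg (PowerSeries.coeff n) hG
      rw [PowerSeries.coeff_derivative, PowerSeries.coeff_mul] at h1 h2
      have h3 : PowerSeries.coeff (n + 1) F * ((n : ℚ) + 1) =
          PowerSeries.coeff (n + 1) G * ((n : ℚ) + 1) := by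
        rw [h1, h2]
        refine Finset.sum_congr rfl fun p hp => ?_
        have := Finset.HasAntidiagonal.mem_antidiagonal.1 hp
        rw [ih p.1 (by omega)]
      exact mul_right_cancel₀ (by positivity) h3

theorem formalExp_mul_formalExp_neg {f : PowerSeries ℚ} (hf : PowerSeries.constantCoeff f = 0) :
    formalExp f * formalExp (-f) = 1 := by
  apply eq_of_derivative_eq_mul (g := 0)
  · rw [Derivation.leibniz, derivative_formalExp hf,
      derivative_formalExp (f := -f) (by simp [hf])]
    simp only [smul_eq_mul, map_neg]
    ring
  · simp
  · simp [constantCoeff_formalExp]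

/-! ### Evaluation at finitely many points -/

/-- The values of the variables `x_i` at the points `y_j`, `j ∈ F`: power sums divided by `i`. -/
noncomputable def pw {ι : Type*} (F : Finset ι) (y : ι → ℚ) (i : ℕ) : ℚ :=
  (∑ j ∈ F, y j ^ (i + 1)) / ((i : ℚ) + 1)

/-- The contribution of one point `t` to the values of the variables `x_i`. -/
noncomputable def pt (t : ℚ) (i : ℕ) : ℚ := t ^ (i + 1) / ((i : ℚ) + 1)

theorem constantCoeff_xSeries : PowerSeries.constantCoeff xSeries = 0 := by
  rw [← PowerSeries.coeff_zero_eq_constantCoeff_apply]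
  simp [xSeries]

theorem constantCoeff_map_xSeries (φ : B →+* ℚ) :
    PowerSeries.constantCoeff (PowerSeries.map φ xSeries) = 0 := by
  rw [← PowerSeries.coeff_zero_eq_constantCoeff_apply, PowerSeries.coeff_map,
    PowerSeries.coeff_zero_eq_constantCoeff_apply, constantCoeff_xSeries, map_zero]

theorem one_sub_mul_mk_pow (t : ℚ) :
    (1 - PowerSeries.C t * PowerSeries.X) * PowerSeries.mk (fun n => t ^ n) = 1 := by
  ext1 m
  rw [sub_mul, one_mul, map_sub, mul_assoc, PowerSeries.coeff_C_mul, PowerSeries.coeff_mk]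
  cases m with
  | zero => simp
  | succ m =>
    rw [PowerSeries.coeff_succ_X_mul, PowerSeries.coeff_mk, PowerSeries.coeff_one]
    simp [pow_succ']

/-- The logarithmic derivative is `-∑ y_j / (1 - y_j z)`, with each fraction written as a geometric
series. -/
theorem derivative_prod_one_sub {ι : Type*} (F : Finset ι) (y : ι → ℚ) :
    PowerSeries.derivative ℚ (∏ j ∈ F, (1 - PowerSeries.C (y j) * PowerSeries.X)) =
      (∏ j ∈ F, (1 - PowerSeries.C (y j) * PowerSeries.X)) *
        -(∑ j ∈ F, PowerSeries.C (y j) * PowerSeries.mk (fun n => y j ^ n)) := by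
  classical
  induction F using Finset.induction_on with
  | empty => simp
  | insert a s ha ih =>
    rw [Finset.prod_insert ha, Derivation.leibniz, ih, Finset.sum_insert ha]
    have h1 : PowerSeries.derivative ℚ (1 - PowerSeries.C (y a) * PowerSeries.X) =
        -PowerSeries.C (y a) := by
      rw [map_sub, Derivation.leibniz]
      simp
    rw [h1]
    have h2 := one_sub_mul_mk_pow (y a)
    simp only [smul_eq_mul]
    linear_combination (∏ j ∈ s, (1 - PowerSeries.C (y j) * PowerSeries.X)) *
      PowerSeries.C (y a) * h2

theorem map_xSeries {ι : Type*} (F : Finset ι) (y : ι → ℚ) :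
    PowerSeries.derivative ℚ (PowerSeries.map
      ((MvPolynomial.aeval (pw F y) : B →ₐ[ℚ] ℚ) : B →+* ℚ) xSeries) =
    ∑ j ∈ F, PowerSeries.C (y j) * PowerSeries.mk (fun n => y j ^ n) := by
  ext1 n
  rw [PowerSeries.coeff_derivative, PowerSeries.coeff_map, xSeries, PowerSeries.coeff_mk,
    if_neg (by omega), map_sum]
  simp only [PowerSeries.coeff_C_mul, PowerSeries.coeff_mk, RingHom.coe_coe,
    MvPolynomial.aeval_X, Nat.add_sub_cancel, pw]
  rw [div_mul_cancel₀ _ (by positivity)]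
  simp [pow_succ']

/-- `exp (- ∑ x_i z ^ i)` at the points `y_j` is `∏ (1 - y_j z)`. -/
theorem map_formalExp_neg_xSeries {ι : Type*} (F : Finset ι) (y : ι → ℚ) :
    PowerSeries.map ((MvPolynomial.aeval (pw F y) : B →ₐ[ℚ] ℚ) : B →+* ℚ)
      (formalExp (-xSeries)) = ∏ j ∈ F, (1 - PowerSeries.C (y j) * PowerSeries.X) := by
  rw [map_formalExp, map_neg]
  apply eq_of_derivative_eq_mul _ (derivative_prod_one_sub F y)
  · rw [constantCoeff_formalExp, map_prod]
    simp
  · rw [derivative_formalExp, map_neg, map_xSeries]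
    rw [map_neg, constantCoeff_map_xSeries, neg_zero]

/-- `exp (∑ x_i z ^ i)` at the points `y_j` is the inverse of `∏ (1 - y_j z)`. -/
theorem map_formalExp_xSeries_mul {ι : Type*} (F : Finset ι) (y : ι → ℚ) :
    PowerSeries.map ((MvPolynomial.aeval (pw F y) : B →ₐ[ℚ] ℚ) : B →+* ℚ)
      (formalExp xSeries) * ∏ j ∈ F, (1 - PowerSeries.C (y j) * PowerSeries.X) = 1 := by
  rw [← map_formalExp_neg_xSeries, map_formalExp, map_formalExp, map_neg]
  exact formalExp_mul_formalExp_neg (constantCoeff_map_xSeries _)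

/-! ### Exponentials of derivations are translations -/

theorem constantCoeff_smul_dSeries (c : ℚ) : PowerSeries.constantCoeff (c • dSeries) = 0 := by
  rw [← PowerSeries.coeff_zero_eq_constantCoeff_apply]
  simp [dSeries]

/-- Multiplication by `p`, as a constant power series of endomorphisms of `B`. -/
noncomputable def mulSeries (p : B) : PowerSeries (Module.End ℚ B) :=
  PowerSeries.C (LinearMap.mulLeft ℚ p)

/-- The Heisenberg relation: the commutator of the derivation with a variable is central. This is
what makes its exponential a translation. -/
theorem dSeries_mul_mulSeries (c : ℚ) (i : ℕ) :
    c • dSeries * mulSeries (MvPolynomial.X i) =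
      mulSeries (MvPolynomial.X i) * (c • dSeries) +
        (c / ((i : ℚ) + 1)) • PowerSeries.X ^ (i + 1) := by
  ext1 n
  rw [map_add, mulSeries, PowerSeries.coeff_mul_C, PowerSeries.coeff_C_mul]
  simp only [PowerSeries.coeff_smul, PowerSeries.coeff_X_pow, dSeries,
    PowerSeries.coeff_mk]
  rcases n with _ | n
  · simp
  · refine LinearMap.ext fun p => ?_
    by_cases hn : n = i
    · subst hn
      simp [Derivation.leibniz, MvPolynomial.smul_eq_C_mul, div_eq_mul_inv]
      ring
    · simp [Derivation.leibniz, hn, MvPolynomial.pderiv_X_of_ne (Ne.symm hn)]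

theorem dSeries_pow_mul_mulSeries (c : ℚ) (i k : ℕ) :
    (c • dSeries) ^ (k + 1) * mulSeries (MvPolynomial.X i) =
      mulSeries (MvPolynomial.X i) * (c • dSeries) ^ (k + 1) +
        (((k : ℚ) + 1) * (c / ((i : ℚ) + 1))) • (PowerSeries.X ^ (i + 1) * (c • dSeries) ^ k) := by
  induction k with
  | zero => simpa using dSeries_mul_mulSeries c i
  | succ k ih =>
    have hX : ∀ f : PowerSeries (Module.End ℚ B),
        f * PowerSeries.X ^ (i + 1) = PowerSeries.X ^ (i + 1) * f :=
      fun f => (PowerSeries.commute_X_pow f (i + 1)).eq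
    rw [pow_succ', mul_assoc, ih, mul_add, ← mul_assoc, dSeries_mul_mulSeries, add_mul,
      mul_assoc, ← pow_succ', mul_smul_comm, ← mul_assoc, hX, mul_assoc, ← pow_succ',
      smul_mul_assoc, add_assoc, ← add_smul]
    congr 2
    push_cast
    ring

theorem formalExp_dSeries_mul_mulSeries (c : ℚ) (i : ℕ) :
    formalExp (c • dSeries) * mulSeries (MvPolynomial.X i) =
      mulSeries (MvPolynomial.X i) * formalExp (c • dSeries) +
        (c / ((i : ℚ) + 1)) • (PowerSeries.X ^ (i + 1) * formalExp (c • dSeries)) := by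
  have h0 := constantCoeff_smul_dSeries c
  ext1 n
  -- The commutator lowers the exponent by one, so these sums are taken one term longer than the one
  -- in `hX`.
  have hL : PowerSeries.coeff n (formalExp (c • dSeries) * mulSeries (MvPolynomial.X i)) =
      ∑ k ∈ Finset.range (n + 2), ((k.factorial : ℚ)⁻¹) •
        PowerSeries.coeff n ((c • dSeries) ^ k * mulSeries (MvPolynomial.X i)) := by
    simp only [mulSeries, PowerSeries.coeff_mul_C]
    rw [coeff_formalExp h0 (show n < n + 2 by omega), Finset.sum_mul]
    simp only [smul_mul_assoc]
  have hR : PowerSeries.coeff n (mulSeries (MvPolynomial.X i) * formalExp (c • dSeries)) =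
      ∑ k ∈ Finset.range (n + 2), ((k.factorial : ℚ)⁻¹) •
        PowerSeries.coeff n (mulSeries (MvPolynomial.X i) * (c • dSeries) ^ k) := by
    simp only [mulSeries, PowerSeries.coeff_C_mul]
    rw [coeff_formalExp h0 (show n < n + 2 by omega), Finset.mul_sum]
    simp only [mul_smul_comm]
  have hX : PowerSeries.coeff n (PowerSeries.X ^ (i + 1) * formalExp (c • dSeries)) =
      ∑ k ∈ Finset.range (n + 1), ((k.factorial : ℚ)⁻¹) •
        PowerSeries.coeff n (PowerSeries.X ^ (i + 1) * (c • dSeries) ^ k) := by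
    simp only [PowerSeries.coeff_X_pow_mul']
    split_ifs with hn
    · exact coeff_formalExp h0 (by omega)
    · simp
  rw [map_add, PowerSeries.coeff_smul, hL, hR, hX, Finset.sum_range_succ',
    Finset.sum_range_succ' (n := n + 1)]
  simp only [dSeries_pow_mul_mulSeries, map_add, PowerSeries.coeff_smul, smul_add,
    Finset.sum_add_distrib, pow_zero, one_mul, mul_one]
  rw [add_right_comm, Finset.smul_sum]
  congr 1
  refine Finset.sum_congr rfl fun k _ => ?_
  rw [smul_smul, smul_smul, Nat.factorial_succ]
  congr 1
  have : ((k : ℚ) + 1) ≠ 0 := by positivity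
  push_cast
  field_simp

theorem coeff_formalExp_dSeries_C (c a : ℚ) (n : ℕ) :
    PowerSeries.coeff n (formalExp (c • dSeries)) (MvPolynomial.C a) =
      if n = 0 then MvPolynomial.C a else 0 := by
  have hk : ∀ k, (PowerSeries.coeff n ((c • dSeries) ^ (k + 1)) : Module.End ℚ B)
      (MvPolynomial.C a) = 0 := by
    intro k
    rw [pow_succ, PowerSeries.coeff_mul, LinearMap.sum_apply]
    refine Finset.sum_eq_zero fun p _ => ?_
    have hz : (PowerSeries.coeff p.2 (c • dSeries) : Module.End ℚ B) (MvPolynomial.C a) = 0 := by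
      rw [PowerSeries.coeff_smul, dSeries, PowerSeries.coeff_mk]
      split_ifs <;> simp
    rw [Module.End.mul_apply, hz, map_zero]
  rw [formalExp, PowerSeries.coeff_mk, Finset.sum_range_succ', LinearMap.add_apply,
    LinearMap.sum_apply]
  simp only [LinearMap.smul_apply, hk, smul_zero, Finset.sum_const_zero, zero_add, pow_zero,
    PowerSeries.coeff_one]
  split_ifs <;> simp

/-- The substitution `x_i ↦ f_i + c w ^ i / i`, with values in `ℚ[w]`. -/
noncomputable def translate (c : ℚ) (f : ℕ → ℚ) : B →ₐ[ℚ] Polynomial ℚ :=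
  MvPolynomial.aeval fun i : ℕ =>
    Polynomial.C (f i) + Polynomial.C (c / ((i : ℚ) + 1)) * Polynomial.X ^ (i + 1)

/-- Taylor's formula. Moving a variable through the exponential shifts it by `c w ^ i / i`, and
constants are fixed, so induction on `τ` gives the substitution. -/
theorem aeval_coeff_formalExp_dSeries (c : ℚ) (f : ℕ → ℚ) (τ : B) (n : ℕ) :
    (MvPolynomial.aeval f : B →ₐ[ℚ] ℚ) (PowerSeries.coeff n (formalExp (c • dSeries)) τ) =
      (translate c f τ).coeff n := by
  induction τ using MvPolynomial.induction_on generalizing n with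
  | C a =>
    rw [coeff_formalExp_dSeries_C, translate, MvPolynomial.aeval_C]
    simp only [Polynomial.algebraMap_apply, Polynomial.coeff_C]
    split_ifs <;> simp
  | add p q hp hq => simp only [map_add, hp, hq, Polynomial.coeff_add]
  | mul_X p i hp =>
    have h1 := congrArg (fun F : PowerSeries (Module.End ℚ B) => PowerSeries.coeff n F p) (formalExp_dSeries_mul_mulSeries c i)
    simp only [mulSeries, PowerSeries.coeff_mul_C, map_add, PowerSeries.coeff_C_mul,
      PowerSeries.coeff_smul, LinearMap.add_apply, Module.End.mul_apply,
      LinearMap.mulLeft_apply, LinearMap.smul_apply, PowerSeries.coeff_X_pow_mul'] at h1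
    rw [mul_comm, h1, map_add, map_mul, map_smul, map_mul, hp]
    have h2 : translate c f (MvPolynomial.X i) =
      Polynomial.C (f i) + Polynomial.C (c / ((i : ℚ) + 1)) * Polynomial.X ^ (i + 1) := by
      simp [translate]
    rw [h2, add_mul, Polynomial.coeff_add, Polynomial.coeff_C_mul, mul_assoc,
      Polynomial.coeff_C_mul, Polynomial.coeff_X_pow_mul', MvPolynomial.aeval_X, smul_eq_mul]
    congr 2
    split_ifs with hn
    · exact hp _
    · simp

/-- At `w = t` the shift is `c` times the contribution of the point `t`: it adds the point for `c =
1` and removes it for `c = -1`. -/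
theorem eval_translate (c : ℚ) (f : ℕ → ℚ) (τ : B) (t : ℚ) :
    (translate c f τ).eval t =
      (MvPolynomial.aeval (fun i => f i + c * pt t i) : B →ₐ[ℚ] ℚ) τ := by
  have : (Polynomial.aeval t).comp (translate c f) =
      (MvPolynomial.aeval (fun i => f i + c * pt t i) : B →ₐ[ℚ] ℚ) := by
    ext i
    simp [translate, pt]
    ring
  rw [← this]
  simp

/-! ### The residue at finitely many points -/

/-- Substitution of `z⁻¹` into a polynomial. -/
noncomputable def invZ : Polynomial ℚ →+* LaurentSeries ℚ :=
  Polynomial.eval₂RingHom HahnSeries.C (HahnSeries.single (-1 : ℤ) (1 : ℚ))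

theorem invZ_monomial (n : ℕ) (a : ℚ) :
    invZ (Polynomial.monomial n a) = HahnSeries.single (-(n : ℤ)) a := by
  rw [invZ, Polynomial.coe_eval₂RingHom, Polynomial.eval₂_monomial, HahnSeries.single_pow,
    HahnSeries.C_apply, HahnSeries.single_mul_single]
  simp

theorem coeff_invZ (g : Polynomial ℚ) (k : ℤ) :
    (invZ g).coeff k = if k ≤ 0 then g.coeff (-k).toNat else 0 := by
  induction g using Polynomial.induction_on' with
  | add p q hp hq =>
    rw [map_add, HahnSeries.coeff_add, hp, hq, Polynomial.coeff_add]
    split_ifs <;> simp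
  | monomial n a =>
    rw [invZ_monomial, HahnSeries.coeff_single, Polynomial.coeff_monomial]
    split_ifs <;> first | rfl | omega

/-- The term `z ^ (-n)` pairs with `z ^ (n - 1)`; for `n = 0` there is no partner, as `Q` has no
negative powers. -/
theorem coeff_invZ_mul_ofPowerSeries (g : Polynomial ℚ) (Q : PowerSeries ℚ) :
    (invZ g * HahnSeries.ofPowerSeries ℤ ℚ Q).coeff (-1) =
      ∑ n ∈ g.support, g.coeff n * if n = 0 then 0 else PowerSeries.coeff (n - 1) Q := by
  conv_lhs => rw [g.as_sum_support]
  rw [map_sum, Finset.sum_mul, HahnSeries.coeff_sum]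
  refine Finset.sum_congr rfl fun n _ => ?_
  rw [invZ_monomial, HahnSeries.coeff_single_mul, PowerSeries.coeff_coe]
  congr 1
  rcases n with _ | n
  · simp
  · rw [if_neg (by push_cast; omega), if_neg (by omega)]
    congr 2
    push_cast
    omega

theorem map_expD (c : ℚ) (f : ℕ → ℚ) (τ : B) :
    (expD c τ).map ((MvPolynomial.aeval f : B →ₐ[ℚ] ℚ) : B →ₙ+* ℚ) = invZ (translate c f τ) := by
  ext k
  have h1 : (expD c τ).coeff k = if k ≤ 0 then
      PowerSeries.coeff (-k).toNat (formalExp (c • dSeries)) τ else 0 := rfl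
  rw [HahnSeries.map_coeff, h1, coeff_invZ]
  split_ifs with h
  · exact aeval_coeff_formalExp_dSeries c f τ _
  · exact map_zero _

theorem map_ofPowerSeries (f : ℕ → ℚ) (F : PowerSeries B) :
    (HahnSeries.ofPowerSeries ℤ B F).map ((MvPolynomial.aeval f : B →ₐ[ℚ] ℚ) : B →ₙ+* ℚ) =
      HahnSeries.ofPowerSeries ℤ ℚ
        (PowerSeries.map ((MvPolynomial.aeval f : B →ₐ[ℚ] ℚ) : B →+* ℚ) F) := by
  ext k
  rw [HahnSeries.map_coeff, PowerSeries.coeff_coe, PowerSeries.coeff_coe]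
  split_ifs with h
  · exact map_zero _
  · rw [PowerSeries.coeff_map]
    rfl

theorem productMap_residue (f g : ℕ → ℚ) (u v : LaurentSeries B) :
    Algebra.TensorProduct.productMap (MvPolynomial.aeval f : B →ₐ[ℚ] ℚ)
      (MvPolynomial.aeval g : B →ₐ[ℚ] ℚ) (residue (laurentTensor u v)) =
    (u.map ((MvPolynomial.aeval f : B →ₐ[ℚ] ℚ) : B →ₙ+* ℚ) *
      v.map ((MvPolynomial.aeval g : B →ₐ[ℚ] ℚ) : B →ₙ+* ℚ)).coeff (-1) := by
  set φ := Algebra.TensorProduct.productMap (MvPolynomial.aeval f : B →ₐ[ℚ] ℚ)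
      (MvPolynomial.aeval g : B →ₐ[ℚ] ℚ) with hφ
  have h1 : φ (residue (laurentTensor u v)) =
      ((laurentTensor u v).map (φ : B ⊗[ℚ] B →ₙ+* ℚ)).coeff (-1) := rfl
  rw [h1, laurentTensor, HahnSeries.map_mul]
  congr 2
  · ext k
    change φ (u.coeff k ⊗ₜ 1) = _
    rw [hφ, Algebra.TensorProduct.productMap_apply_tmul, map_one, mul_one]
    rfl
  · ext k
    change φ (1 ⊗ₜ v.coeff k) = _
    rw [hφ, Algebra.TensorProduct.productMap_apply_tmul, map_one, one_mul]
    rfl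

/-! ### Lagrange interpolation and partial fractions. -/

theorem eval_eq_sum_interpolate {κ : Type*} [DecidableEq κ] {F : Finset κ} {y : κ → ℚ}
    (hy : Set.InjOn y F) {f : Polynomial ℚ} (hf : f.degree < F.card) (t : ℚ) :
    f.eval t = ∑ j ∈ F, f.eval (y j) * ∏ k ∈ F.erase j, ((t - y k) / (y j - y k)) := by
  conv_lhs => rw [Lagrange.eq_interpolate hy hf, Lagrange.interpolate_apply]
  rw [Polynomial.eval_finsetSum]
  refine Finset.sum_congr rfl fun j _ => ?_
  rw [Polynomial.eval_mul, Polynomial.eval_C, Lagrange.basis, Polynomial.eval_prod]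
  congr 1
  refine Finset.prod_congr rfl fun k _ => ?_
  simp [Lagrange.basisDivisor, div_eq_inv_mul]

/-- The residue at `y'_j` of `∏ (w - y_b) / ∏ (w - y'_k)`. -/
noncomputable def lagrangeWeight {ι κ : Type*} [DecidableEq κ] (F : Finset ι) (y : ι → ℚ)
    (F' : Finset κ) (y' : κ → ℚ) (j : κ) : ℚ :=
  (∏ b ∈ F, (y' j - y b)) / ∏ k ∈ F'.erase j, (y' j - y' k)

/-- Interpolate `∏ (w - y_b)` at the nodes `y'_k`, put `w = x⁻¹` and multiply by `x ^ (|F| + 1)`.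
Having exactly two extra nodes leaves a single factor `x` on the right. -/
theorem sum_lagrangeWeight_mul_prod {ι κ : Type*} [DecidableEq κ] {F : Finset ι} {y : ι → ℚ}
    {F' : Finset κ} {y' : κ → ℚ} (hy' : Set.InjOn y' F') (hc : F'.card = F.card + 2) :
    ∑ j ∈ F', Polynomial.C (lagrangeWeight F y F' y' j) *
        ∏ k ∈ F'.erase j, (1 - Polynomial.C (y' k) * Polynomial.X) =
      Polynomial.X * ∏ b ∈ F, (1 - Polynomial.C (y b) * Polynomial.X) := by
  apply Polynomial.eq_of_infinite_eval_eq
  -- The nonzero rationals are infinitely many, and there `x⁻¹` makes sense.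
  refine (Set.finite_singleton (0 : ℚ)).infinite_compl.mono fun x hx => ?_
  have hx : x ≠ 0 := hx
  have h1 : ∀ v : ℚ, 1 - v * x = x * (x⁻¹ - v) := fun v => by field_simp
  have h2 := eval_eq_sum_interpolate hy' (f := Lagrange.nodal F y)
    (by rw [Lagrange.degree_nodal]; exact_mod_cast (by omega)) x⁻¹
  simp only [Lagrange.eval_nodal] at h2
  simp only [Set.mem_ofPred_eq, Polynomial.eval_finsetSum, Polynomial.eval_mul, Polynomial.eval_C,
    Polynomial.eval_prod, Polynomial.eval_sub, Polynomial.eval_one, Polynomial.eval_X, h1,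
    Finset.prod_mul_distrib, Finset.prod_const, h2]
  rw [Finset.mul_sum, Finset.mul_sum]
  refine Finset.sum_congr rfl fun j hj => ?_
  rw [Finset.card_erase_of_mem hj, hc, lagrangeWeight, Finset.prod_div_distrib,
    show F.card + 2 - 1 = F.card + 1 by omega]
  ring

/-- The partial fraction expansion `∑ c_j / (1 - y'_j z)` of `z ∏ (1 - y_b z) / ∏ (1 - y'_k z)`,
obtained by dividing the preceding identity by the denominator. -/
theorem mk_lagrangeWeight {ι κ : Type*} [DecidableEq κ] {F : Finset ι} {y : ι → ℚ}
    {F' : Finset κ} {y' : κ → ℚ} (hy' : Set.InjOn y' F') (hc : F'.card = F.card + 2) :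
    PowerSeries.mk (fun n => ∑ j ∈ F', lagrangeWeight F y F' y' j * y' j ^ n) =
      PowerSeries.X * ((∏ b ∈ F, (1 - PowerSeries.C (y b) * PowerSeries.X)) *
        PowerSeries.map ((MvPolynomial.aeval (pw F' y') : B →ₐ[ℚ] ℚ) : B →+* ℚ)
          (formalExp xSeries)) := by
  set D := ∏ k ∈ F', (1 - PowerSeries.C (y' k) * PowerSeries.X) with hD
  set E := PowerSeries.map ((MvPolynomial.aeval (pw F' y') : B →ₐ[ℚ] ℚ) : B →+* ℚ)
    (formalExp xSeries)
  have hED : E * D = 1 := map_formalExp_xSeries_mul F' y'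
  have h1 := congrArg (Polynomial.coeToPowerSeries.ringHom (R := ℚ))
    (sum_lagrangeWeight_mul_prod (y := y) hy' hc)
  simp only [map_sum, map_mul, map_prod, map_sub, map_one,
    Polynomial.coeToPowerSeries.ringHom_apply, Polynomial.coe_C, Polynomial.coe_X] at h1
  have h2 : D * PowerSeries.mk (fun n => ∑ j ∈ F', lagrangeWeight F y F' y' j * y' j ^ n) =
      PowerSeries.X * ∏ b ∈ F, (1 - PowerSeries.C (y b) * PowerSeries.X) := by
    rw [← h1]
    have h3 : PowerSeries.mk (fun n => ∑ j ∈ F', lagrangeWeight F y F' y' j * y' j ^ n) =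
        ∑ j ∈ F', PowerSeries.C (lagrangeWeight F y F' y' j) *
          PowerSeries.mk (fun n => y' j ^ n) := by
      ext n
      simp
    rw [h3, Finset.mul_sum]
    refine Finset.sum_congr rfl fun j hj => ?_
    rw [hD, ← Finset.mul_prod_erase _ _ hj]
    linear_combination (PowerSeries.C (lagrangeWeight F y F' y' j) *
      ∏ k ∈ F'.erase j, (1 - PowerSeries.C (y' k) * PowerSeries.X)) * one_sub_mul_mk_pow (y' j)
  linear_combination E * h2 - PowerSeries.mk (fun n => ∑ j ∈ F', lagrangeWeight F y F' y' j *
    y' j ^ n) * hED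

/-- The bilinear residue, evaluated at two finite sets of points, is a sum over the points of the
second set. -/
theorem productMap_residue_Gam {ι κ : Type*} [DecidableEq κ] {F : Finset ι} {y : ι → ℚ}
    {F' : Finset κ} {y' : κ → ℚ} (hy' : Set.InjOn y' F') (hc : F'.card = F.card + 2) (τ : B) :
    Algebra.TensorProduct.productMap (MvPolynomial.aeval (pw F y) : B →ₐ[ℚ] ℚ)
      (MvPolynomial.aeval (pw F' y') : B →ₐ[ℚ] ℚ)
      (residue (laurentTensor (GamStar τ) (Gam τ))) =
    ∑ j ∈ F', lagrangeWeight F y F' y' j *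
      ((MvPolynomial.aeval (fun i => pw F y i + 1 * pt (y' j) i) : B →ₐ[ℚ] ℚ) τ *
        (MvPolynomial.aeval (fun i => pw F' y' i + -1 * pt (y' j) i) : B →ₐ[ℚ] ℚ) τ) := by
  rw [productMap_residue, GamStar, Gam, HahnSeries.map_mul, HahnSeries.map_mul,
    map_ofPowerSeries, map_ofPowerSeries, map_expD, map_expD, map_formalExp_neg_xSeries]
  have hmk := mk_lagrangeWeight (y := y) hy' hc
  set N := ∏ b ∈ F, (1 - PowerSeries.C (y b) * PowerSeries.X)
  set E := PowerSeries.map ((MvPolynomial.aeval (pw F' y') : B →ₐ[ℚ] ℚ) : B →+* ℚ)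
    (formalExp xSeries)
  set g := translate 1 (pw F y) τ * translate (-1) (pw F' y') τ with hg
  have h1 : HahnSeries.ofPowerSeries ℤ ℚ N * invZ (translate 1 (pw F y) τ) *
      (HahnSeries.ofPowerSeries ℤ ℚ E * invZ (translate (-1) (pw F' y') τ)) =
      invZ g * HahnSeries.ofPowerSeries ℤ ℚ (N * E) := by
    rw [hg, map_mul, map_mul]
    ring
  rw [h1, coeff_invZ_mul_ofPowerSeries]
  -- These are the coefficients of `z N E`, that is, weighted power sums of the `y'_j`; summed
  -- against the coefficients of `g` they give the weighted values `g(y'_j)`.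
  have h2 : ∀ n, (if n = 0 then 0 else PowerSeries.coeff (n - 1) (N * E)) =
      ∑ j ∈ F', lagrangeWeight F y F' y' j * y' j ^ n := by
    intro n
    have := congrArg (PowerSeries.coeff n) hmk
    rw [PowerSeries.coeff_mk] at this
    rw [this]
    rcases n with _ | n
    · simp
    · rw [if_neg (by omega), PowerSeries.coeff_succ_X_mul, Nat.add_sub_cancel]
  simp_rw [h2, Finset.mul_sum]
  rw [Finset.sum_comm]
  refine Finset.sum_congr rfl fun j _ => ?_
  rw [← eval_translate, ← eval_translate, ← Polynomial.eval_mul, ← hg, Polynomial.eval_eq_sum,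
    Polynomial.sum, Finset.mul_sum]
  exact Finset.sum_congr rfl fun n _ => by ring

/-! ### Exchange relations -/

/-- Interpolation is exact on `t ^ m` for `m < s`, so the new row is a combination of the old rows
with Lagrange coefficients; only the `j`-th one survives in the determinant. -/
theorem det_vandermonde_update {s : ℕ} {y : Fin s → ℚ} (hy : Function.Injective y) (j : Fin s)
    (t : ℚ) :
    (Matrix.vandermonde (Function.update y j t)).det =
      (Matrix.vandermonde y).det * ∏ k ∈ Finset.univ.erase j, ((t - y k) / (y j - y k)) := by
  have h1 : Matrix.vandermonde (Function.update y j t) =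
      (Matrix.vandermonde y).updateRow j (∑ i, (∏ k ∈ Finset.univ.erase i,
        ((t - y k) / (y i - y k))) • Matrix.vandermonde y i) := by
    ext i m
    rw [Matrix.updateRow_apply]
    split_ifs with hij
    · subst hij
      have := eval_eq_sum_interpolate (F := Finset.univ) hy.injOn (f := Polynomial.X ^ (m : ℕ))
        (by rw [Polynomial.degree_X_pow]; simp) t
      simp only [Polynomial.eval_pow, Polynomial.eval_X] at this
      simp [Matrix.vandermonde_apply, this, mul_comm]
    · simp [Matrix.vandermonde_apply, hij]
  rw [h1, Matrix.det_updateRow_sum, smul_eq_mul, mul_comm]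

/-- The value of `τ` at the points `y`, times the Vandermonde determinant. -/
noncomputable def alternant (τ : B) {s : ℕ} (y : Fin s → ℚ) : ℚ :=
  (MvPolynomial.aeval (pw Finset.univ y) : B →ₐ[ℚ] ℚ) τ * (Matrix.vandermonde y).det

theorem pw_update {s : ℕ} (y : Fin s → ℚ) (j : Fin s) (t : ℚ) (i : ℕ) :
    pw Finset.univ (Function.update y j t) i = pw (Finset.univ.erase j) y i + pt t i := by
  rw [pw, pw, pt, ← Finset.add_sum_erase _ _ (Finset.mem_univ j), ← add_div, add_comm]
  congr 2
  · refine Finset.sum_congr rfl fun k hk => ?_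
    rw [Function.update_of_ne (Finset.ne_of_mem_erase hk)]
  · simp

theorem pw_univ {s : ℕ} (y : Fin s → ℚ) (j : Fin s) (i : ℕ) :
    pw Finset.univ y i = pw (Finset.univ.erase j) y i + pt (y j) i := by
  rw [← pw_update, Function.update_eq_self]

theorem pw_option {s : ℕ} (u : ℚ) (y : Fin s → ℚ) (i : ℕ) :
    pw Finset.univ (fun o : Option (Fin s) => o.elim u y) i = pt u i + pw Finset.univ y i := by
  rw [pw, Fintype.sum_option, add_div, pw, pt]
  rfl

/-- In the residue sum, moving `y₀ a` between the two sets restores `y₀` and `y`, while moving `y j`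
exchanges it with `y₀ a`. The Lagrange weights match ratios of Vandermonde determinants. The
prefactor on the right is nonzero under the hypotheses. -/
theorem alternant_exchange (τ : B) {s : ℕ} {y₀ y : Fin s → ℚ} (hy₀ : Function.Injective y₀)
    (hy : Function.Injective y) (a : Fin s) (hu : ∀ k, y₀ a ≠ y k) :
    alternant τ y₀ * alternant τ y - ∑ j, alternant τ (Function.update y₀ a (y j)) *
        alternant τ (Function.update y j (y₀ a)) =
      (Matrix.vandermonde y₀).det * (Matrix.vandermonde y).det *
        ((∏ k, (y₀ a - y k)) / ∏ b ∈ Finset.univ.erase a, (y₀ a - y₀ b)) *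
      Algebra.TensorProduct.productMap
        (MvPolynomial.aeval (pw (Finset.univ.erase a) y₀) : B →ₐ[ℚ] ℚ)
        (MvPolynomial.aeval (pw Finset.univ (fun o : Option (Fin s) => o.elim (y₀ a) y)) :
          B →ₐ[ℚ] ℚ) (residue (laurentTensor (GamStar τ) (Gam τ))) := by
  have hP : ∏ b ∈ Finset.univ.erase a, (y₀ a - y₀ b) ≠ 0 := by
    refine Finset.prod_ne_zero_iff.2 fun b hb => sub_ne_zero.2 fun h => ?_
    exact Finset.ne_of_mem_erase hb (hy₀ h).symm
  have hQ : ∏ k, (y₀ a - y k) ≠ 0 :=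
    Finset.prod_ne_zero_iff.2 fun k _ => sub_ne_zero.2 (hu k)
  rw [productMap_residue_Gam, Fintype.sum_option, mul_add, sub_eq_add_neg]
  · congr 1
    · have h1 : (fun i => pw (Finset.univ.erase a) y₀ i + 1 * pt (y₀ a) i) =
          pw Finset.univ y₀ := by
        funext i
        rw [pw_univ y₀ a, one_mul]
      have h2 : (fun i => pw Finset.univ (fun o : Option (Fin s) => o.elim (y₀ a) y) i +
          -1 * pt (y₀ a) i) = pw Finset.univ y := by
        funext i
        rw [pw_option]
        ring
      have h3 : ∏ k ∈ (Finset.univ : Finset (Option (Fin s))).erase none,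
          (y₀ a - k.elim (y₀ a) y) = ∏ k, (y₀ a - y k) := by
        have : (Finset.univ : Finset (Option (Fin s))).erase none =
            Finset.univ.map Function.Embedding.some := by
          ext o
          cases o <;> simp
        rw [this, Finset.prod_map]
        rfl
      simp only [Option.elim_none]
      rw [h1, h2, lagrangeWeight]
      simp only [Option.elim_none]
      rw [h3, alternant, alternant]
      field_simp
    · rw [Finset.mul_sum, ← Finset.sum_neg_distrib]
      refine Finset.sum_congr rfl fun j _ => ?_
      have h1 : (fun i => pw (Finset.univ.erase a) y₀ i + 1 * pt (y j) i) =
          pw Finset.univ (Function.update y₀ a (y j)) := by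
        funext i
        rw [pw_update, one_mul]
      have h2 : (fun i => pw Finset.univ (fun o : Option (Fin s) => o.elim (y₀ a) y) i +
          -1 * pt (y j) i) = pw Finset.univ (Function.update y j (y₀ a)) := by
        funext i
        rw [pw_option, pw_univ y j, pw_update]
        ring
      have h3 : ∏ k ∈ (Finset.univ : Finset (Option (Fin s))).erase (some j),
          (y j - k.elim (y₀ a) y) =
            (y j - y₀ a) * ∏ k ∈ Finset.univ.erase j, (y j - y k) := by
        have : (Finset.univ : Finset (Option (Fin s))).erase (some j) =
            Finset.insertNone (Finset.univ.erase j) := by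
          ext o
          cases o <;> simp
        rw [this, Finset.prod_insertNone]
        rfl
      have hR : ∏ k ∈ Finset.univ.erase j, (y j - y k) ≠ 0 := by
        refine Finset.prod_ne_zero_iff.2 fun b hb => sub_ne_zero.2 fun h => ?_
        exact Finset.ne_of_mem_erase hb (hy h).symm
      have hj : y j - y₀ a ≠ 0 := sub_ne_zero.2 (hu j).symm
      simp only [Option.elim_some]
      rw [h1, h2, lagrangeWeight]
      simp only [Option.elim_some]
      rw [h3, alternant, alternant, det_vandermonde_update hy₀, det_vandermonde_update hy,
        ← Finset.mul_prod_erase Finset.univ (fun k => y₀ a - y k) (Finset.mem_univ j),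
        Finset.prod_div_distrib, Finset.prod_div_distrib]
      field_simp
      ring
  · have : Function.Injective (fun o : Option (Fin s) => o.elim (y₀ a) y) := by
      rintro (_ | i) (_ | k) h
      · rfl
      · exact absurd h (hu k)
      · exact absurd h.symm (hu i)
      · exact congrArg some (hy h)
    exact this.injOn
  · have := a.2
    simp
    omega

/-- The exchange relations for determinants. -/
theorem det_exchange {s : ℕ} (f : Fin s → ℚ → ℚ) (y₀ y : Fin s → ℚ) (a : Fin s) :
    (Matrix.of fun i j => f i (y₀ j)).det * (Matrix.of fun i j => f i (y j)).det =
      ∑ j, (Matrix.of fun i k => f i (Function.update y₀ a (y j) k)).det *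
        (Matrix.of fun i k => f i (Function.update y j (y₀ a) k)).det := by
  have hup : ∀ (x : Fin s → ℚ) (j : Fin s) (t : ℚ),
      (Matrix.of fun i k => f i (Function.update x j t k)) =
        (Matrix.of fun i k => f i (x k)).updateCol j (fun i => f i t) := by
    intro x j t
    ext i k
    rw [Matrix.updateCol_apply, Matrix.of_apply, Function.update_apply]
    split_ifs <;> rfl
  simp_rw [hup, ← Matrix.cramer_apply]
  set P := Matrix.of fun i j => f i (y₀ j)
  set Q := Matrix.of fun i j => f i (y j)
  -- Cramer's rule writes `det Q` times the column of `y₀ a` as a combination of the columns of `Q`,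
  -- without assuming `Q` invertible. Putting this vector in column `a` of `P` gives the relation.
  have h1 := Matrix.mulVec_cramer Q (fun i => f i (y₀ a))
  have h2 : Q.mulVec (Matrix.cramer Q fun i => f i (y₀ a)) =
      ∑ j, Matrix.cramer Q (fun i => f i (y₀ a)) j • fun i => f i (y j) := by
    ext i
    simp [Q, Matrix.mulVec, dotProduct, mul_comm]
  have h3 := congrArg (fun v => Matrix.cramer P v a) (h2.symm.trans h1)
  simp only [map_sum, map_smul, Finset.sum_apply, Pi.smul_apply, smul_eq_mul] at h3
  have h4 : Matrix.cramer P (fun i => f i (y₀ a)) a = P.det := by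
    rw [Matrix.cramer_row_self P (fun i => f i (y₀ a)) a (fun _ => rfl), Pi.single_eq_same]
  rw [h4] at h3
  rw [mul_comm, ← h3]
  exact Finset.sum_congr rfl fun j _ => mul_comm _ _

/-- Two alternating functions that satisfy the exchange relations with respect to `y₀` and agree on
the tuples that differ from `y₀` in at most one place are equal. -/
theorem eq_of_exchange {s : ℕ} {A D : (Fin s → ℚ) → ℚ} {y₀ : Fin s → ℚ}
    (hA : ∀ y, ¬ Function.Injective y → A y = 0) (hD : ∀ y, ¬ Function.Injective y → D y = 0)
    (hAσ : ∀ (y : Fin s → ℚ) (σ : Equiv.Perm (Fin s)), A (y ∘ σ) = (Equiv.Perm.sign σ : ℤ) * A y)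
    (hDσ : ∀ (y : Fin s → ℚ) (σ : Equiv.Perm (Fin s)), D (y ∘ σ) = (Equiv.Perm.sign σ : ℤ) * D y)
    (h₀ : A y₀ = 1)
    (hAD : ∀ a t, D (Function.update y₀ a t) = A (Function.update y₀ a t)) (hD₀ : D y₀ = 1)
    (hAe : ∀ y, Function.Injective y → ∀ a, (∀ k, y₀ a ≠ y k) →
      A y₀ * A y = ∑ j, A (Function.update y₀ a (y j)) * A (Function.update y j (y₀ a)))
    (hDe : ∀ y a, D y₀ * D y =
      ∑ j, D (Function.update y₀ a (y j)) * D (Function.update y j (y₀ a))) (y : Fin s → ℚ) :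
    A y = D y := by
  classical
  -- Induction on the number of entries of `y₀` missing from `y`: exchanging a missing one into `y`
  -- lowers it.
  obtain ⟨n, hn⟩ : ∃ n, (Finset.univ.filter fun b => ∀ k, y₀ b ≠ y k).card = n := ⟨_, rfl⟩
  induction n using Nat.strong_induction_on generalizing y with
  | _ n ih =>
    by_cases hy : Function.Injective y
    swap
    · rw [hA y hy, hD y hy]
    by_cases ha : ∃ a, ∀ k, y₀ a ≠ y k
    · obtain ⟨a, ha⟩ := ha
      have h1 := hAe y hy a ha
      have h2 := hDe y a
      rw [h₀, one_mul] at h1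
      rw [hD₀, one_mul] at h2
      rw [h1, h2]
      refine Finset.sum_congr rfl fun j _ => ?_
      rw [hAD]
      -- If `y j` is another entry of `y₀`, the first factor vanishes; otherwise discarding `y j`
      -- loses no entry of `y₀`.
      by_cases hj : Function.Injective (Function.update y₀ a (y j))
      swap
      · rw [hA _ hj, zero_mul, zero_mul]
      congr 1
      refine ih _ ?_ _ rfl
      rw [← hn]
      apply Finset.card_lt_card
      rw [Finset.ssubset_iff_of_subset]
      · refine ⟨a, by simpa using ha, ?_⟩
        simp only [Finset.mem_filter, Finset.mem_univ, true_and, not_forall, not_not]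
        exact ⟨j, by simp⟩
      · intro b
        simp only [Finset.mem_filter, Finset.mem_univ, true_and]
        intro hb k hk
        by_cases hkj : k = j
        · subst hkj
          have hba : b ≠ a := by
            rintro rfl
            exact ha k hk
          apply hba
          apply hj
          rw [Function.update_of_ne hba, Function.update_self, hk]
        · apply hb k
          rw [Function.update_of_ne hkj, hk]
    -- No entry is missing, so `y` is a permutation of `y₀` and antisymmetry decides.
    · push Not at ha
      choose σ hσ using ha
      have hinj : Function.Injective y₀ := by
        by_contra h
        rw [hA _ h] at h₀
        exact zero_ne_one h₀
      have hσi : Function.Injective σ := by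
        intro b c hbc
        apply hinj
        rw [hσ, hσ, hbc]
      let e : Equiv.Perm (Fin s) := Equiv.ofBijective σ (Finite.injective_iff_bijective.1 hσi)
      have he : y₀ = y ∘ e := funext hσ
      have h1 := hAσ y e
      have h2 := hDσ y e
      rw [← he] at h1 h2
      rw [h₀] at h1
      rw [hD₀, h1] at h2
      have h3 : (((Equiv.Perm.sign e : ℤˣ) : ℤ) : ℚ) ≠ 0 := by
        rcases Int.units_eq_one_or (Equiv.Perm.sign e) with h | h <;> simp [h]
      exact mul_left_cancel₀ h3 h2

theorem det_of_comp_perm {s : ℕ} (f : Fin s → ℚ → ℚ) (y : Fin s → ℚ) (σ : Equiv.Perm (Fin s)) :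
    (Matrix.of fun i j => f i ((y ∘ σ) j)).det =
      (Equiv.Perm.sign σ : ℤ) * (Matrix.of fun i j => f i (y j)).det := by
  rw [← Matrix.det_permute']
  rfl

theorem det_of_not_injective {s : ℕ} (f : Fin s → ℚ → ℚ) {y : Fin s → ℚ}
    (hy : ¬ Function.Injective y) : (Matrix.of fun i j => f i (y j)).det = 0 := by
  simp only [Function.Injective, not_forall] at hy
  obtain ⟨j, k, hjk, hne⟩ := hy
  exact Matrix.det_zero_of_column_eq hne fun i => by simp [hjk]

/-- An alternating function that satisfies the exchange relations is a determinant. -/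
theorem eq_det_of_exchange {s : ℕ} {A : (Fin s → ℚ) → ℚ} {y₀ : Fin s → ℚ} (h₀ : A y₀ ≠ 0)
    (hA : ∀ y, ¬ Function.Injective y → A y = 0)
    (hAσ : ∀ (y : Fin s → ℚ) (σ : Equiv.Perm (Fin s)), A (y ∘ σ) = (Equiv.Perm.sign σ : ℤ) * A y)
    (hAe : ∀ y, Function.Injective y → ∀ a, (∀ k, y₀ a ≠ y k) →
      A y₀ * A y = ∑ j, A (Function.update y₀ a (y j)) * A (Function.update y j (y₀ a)))
    (y : Fin s → ℚ) :
    A y = A y₀ * (Matrix.of fun i j => A (Function.update y₀ i (y j)) / A y₀).det := by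
  set f : Fin s → ℚ → ℚ := fun i t => A (Function.update y₀ i t) / A y₀ with hf
  -- Off the diagonal a point is repeated, so `A` vanishes. Changing one entry of `y₀` thus changes
  -- one column of the identity, whose determinant is the diagonal entry.
  have hone : (Matrix.of fun i j => f i (y₀ j)) = 1 := by
    ext i j
    rw [Matrix.of_apply, Matrix.one_apply, hf]
    split_ifs with hij
    · subst hij
      simp [h₀]
    · have : ¬ Function.Injective (Function.update y₀ i (y₀ j)) := fun h => by
        refine hij (h ?_)
        rw [Function.update_self, Function.update_of_ne (Ne.symm hij)]
      simp [hA _ this]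
  have key := eq_of_exchange (A := fun y => A y / A y₀)
    (D := fun y => (Matrix.of fun i j => f i (y j)).det) (y₀ := y₀)
    (fun y hy => by simp [hA y hy]) (fun y hy => det_of_not_injective f hy)
    (fun y σ => by simp only [hAσ, mul_div_assoc]) (det_of_comp_perm f) (div_self h₀)
    (fun a t => by
      have h1 : (Matrix.of fun i k => f i (Function.update y₀ a t k)) =
          (1 : Matrix (Fin s) (Fin s) ℚ).updateCol a (fun i => f i t) := by
        rw [← hone]
        ext i k
        rw [Matrix.updateCol_apply, Matrix.of_apply, Function.update_apply]
        split_ifs <;> rfl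
      rw [h1, ← Matrix.cramer_apply, Matrix.cramer_one]
      rfl)
    (by rw [hone, Matrix.det_one])
    (fun y hy a ha => by
      have h1 := hAe y hy a ha
      calc A y₀ / A y₀ * (A y / A y₀) = (A y₀ * A y) / (A y₀ * A y₀) := by ring
        _ = _ := by
          rw [h1, Finset.sum_div]
          exact Finset.sum_congr rfl fun j _ => by rw [div_mul_div_comm])
    (fun y a => det_exchange f y₀ y a) y
  rw [← key, mul_div_cancel₀ _ h₀]

theorem alternant_of_not_injective (τ : B) {s : ℕ} {y : Fin s → ℚ}
    (hy : ¬ Function.Injective y) : alternant τ y = 0 := by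
  rw [alternant, ← Matrix.det_transpose]
  have := det_of_not_injective (fun (i : Fin s) t => t ^ (i : ℕ)) hy
  rw [show (Matrix.vandermonde y).transpose =
    Matrix.of fun i j : Fin s => y j ^ (i : ℕ) from rfl, this,
    mul_zero]

theorem alternant_comp_perm (τ : B) {s : ℕ} (y : Fin s → ℚ) (σ : Equiv.Perm (Fin s)) :
    alternant τ (y ∘ σ) = (Equiv.Perm.sign σ : ℤ) * alternant τ y := by
  have h1 : pw Finset.univ (y ∘ σ) = pw Finset.univ y := by
    funext i
    simp only [pw, Function.comp_apply]
    rw [Equiv.sum_comp σ fun j => y j ^ (i + 1)]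
  have h2 : (Matrix.vandermonde (y ∘ σ)).det =
      (Equiv.Perm.sign σ : ℤ) * (Matrix.vandermonde y).det := by
    rw [← Matrix.det_permute]
    rfl
  rw [alternant, alternant, h1, h2]
  ring

/-! ### Symmetric polynomials and the rings `ℚ[e₁, …, e_r]` -/

theorem coeff_E (s : ℕ) (i : Fin s) :
    PowerSeries.coeff ((i : ℕ) + 1) (E s) = (-1) ^ ((i : ℕ) + 1) * MvPolynomial.X i := by
  rw [E, map_add, PowerSeries.coeff_one, if_neg (by omega), zero_add, map_sum,
    Finset.sum_eq_single i]
  · rw [PowerSeries.coeff_C_mul, PowerSeries.coeff_X_pow, if_pos rfl, mul_one]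
  · intro j _ hj
    rw [PowerSeries.coeff_C_mul, PowerSeries.coeff_X_pow, if_neg, mul_zero]
    intro h
    exact hj (Fin.ext (by omega))
  · simp

/-- Both routes send `e_i` to the elementary symmetric function of the points, read off from `∏ (1 -
y_j z)`. -/
theorem aeval_pw_incl {s : ℕ} (p : Br s) (y : Fin s → ℚ) :
    (MvPolynomial.aeval (pw Finset.univ y) : B →ₐ[ℚ] ℚ) (incl s p) =
      MvPolynomial.eval y (toSymm s p) := by
  have h1 : (MvPolynomial.aeval (pw Finset.univ y) : B →ₐ[ℚ] ℚ).comp (incl s) =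
      (MvPolynomial.aeval y : Br s →ₐ[ℚ] ℚ).comp (toSymm s) := by
    ext i
    have h2 := congrArg (PowerSeries.coeff ((i : ℕ) + 1)) (congrArg
      (PowerSeries.map (MvPolynomial.eval y)) (prod_one_add_eq (r := s)))
    have h3 := congrArg (PowerSeries.coeff ((i : ℕ) + 1))
      (map_formalExp_neg_xSeries Finset.univ y)
    rw [map_prod] at h2
    simp only [map_sub, map_one, map_mul, PowerSeries.map_C, PowerSeries.map_X,
      MvPolynomial.eval_X] at h2
    rw [← h2, PowerSeries.coeff_map, PowerSeries.coeff_map, PowerSeries.coeff_map, coeff_E] at h3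
    simp only [AlgHom.comp_apply, incl, MvPolynomial.aeval_X, eInf]
    rw [map_mul, map_pow, map_neg, map_one]
    simp only [RingHom.coe_coe] at h3
    rw [h3, map_mul, map_pow, map_neg, map_one, map_mul, map_pow, map_neg, map_one, ← mul_assoc,
      ← mul_pow]
    simp
  have h4 := congrArg (fun φ : Br s →ₐ[ℚ] ℚ => φ p) h1
  simpa using h4

theorem eInf_mem_range {n k : ℕ} (hk : k ≤ n) : eInf k ∈ (incl n).range := by
  rcases k with _ | k
  · have : eInf 0 = 1 := by
      rw [eInf, PowerSeries.coeff_zero_eq_constantCoeff_apply, constantCoeff_formalExp]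
      simp
    rw [this]
    exact one_mem _
  · exact ⟨MvPolynomial.X ⟨k, hk⟩, by simp [incl]⟩

/-- Newton's recursion: differentiating `exp (-∑ x_i z ^ i)` expresses a multiple of each variable
through the `e_i` and the earlier variables. -/
theorem X_mem_range {n k : ℕ} (hk : k < n) : (MvPolynomial.X k : B) ∈ (incl n).range := by
  induction k using Nat.strong_induction_on with
  | _ k ih =>
    have hc : ∀ j, j ≤ n → PowerSeries.coeff j (formalExp (-xSeries)) ∈ (incl n).range := by
      intro j hj
      have h1 : PowerSeries.coeff j (formalExp (-xSeries)) = (-1) ^ j * eInf j := by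
        rw [eInf, ← mul_assoc, ← mul_pow]
        simp
      rw [h1]
      exact mul_mem (pow_mem (neg_mem (one_mem _)) _) (eInf_mem_range hj)
    have h1 := congrArg (PowerSeries.coeff k)
      (derivative_formalExp (f := -xSeries) (by simp [constantCoeff_xSeries]))
    have hx : ∀ q, PowerSeries.coeff q (PowerSeries.derivative B (-xSeries)) =
        -(((q : B) + 1) * MvPolynomial.X q) := by
      intro q
      rw [PowerSeries.coeff_derivative, map_neg, xSeries, PowerSeries.coeff_mk,
        if_neg (by omega), Nat.add_sub_cancel]
      ring
    rw [PowerSeries.coeff_derivative, PowerSeries.coeff_mul,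
      Finset.Nat.sum_antidiagonal_eq_sum_range_succ_mk, Finset.sum_range_succ'] at h1
    simp only [hx, Nat.sub_zero] at h1
    rw [PowerSeries.coeff_zero_eq_constantCoeff_apply, constantCoeff_formalExp, one_mul] at h1
    have hn : ∀ m : ℕ, (m : B) + 1 ∈ (incl n).range :=
      fun m => add_mem (natCast_mem _ m) (one_mem _)
    have h2 : ((k : B) + 1) * MvPolynomial.X k ∈ (incl n).range := by
      have h3 : ((k : B) + 1) * MvPolynomial.X k =
          (∑ j ∈ Finset.range k, PowerSeries.coeff (j + 1) (formalExp (-xSeries)) *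
            -((((k - (j + 1) : ℕ) : B) + 1) * MvPolynomial.X (k - (j + 1)))) -
          PowerSeries.coeff (k + 1) (formalExp (-xSeries)) * ((k : B) + 1) := by
        rw [h1]
        ring
      rw [h3]
      refine sub_mem (sum_mem fun j hj => ?_) (mul_mem (hc _ hk) (hn k))
      have := Finset.mem_range.1 hj
      exact mul_mem (hc _ (by omega)) (neg_mem (mul_mem (hn _) (ih _ (by omega) (by omega))))
    have h4 := (incl n).range.smul_mem h2 (((k : ℚ) + 1)⁻¹)
    have h5 : ((k : B) + 1) * MvPolynomial.X k = ((k : ℚ) + 1) • (MvPolynomial.X k : B) := by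
      rw [MvPolynomial.smul_eq_C_mul]
      simp
    rwa [h5, smul_smul, inv_mul_cancel₀ (by positivity), one_smul] at h4

theorem exists_forall_mem_range (τ : B) : ∃ N, ∀ n ≥ N, τ ∈ (incl n).range := by
  induction τ using MvPolynomial.induction_on with
  | C a => exact ⟨0, fun n _ => (incl n).range.algebraMap_mem a⟩
  | add p q hp hq =>
    obtain ⟨N, hN⟩ := hp
    obtain ⟨N', hN'⟩ := hq
    exact ⟨max N N', fun n hn => add_mem (hN n (le_of_max_le_left hn))
      (hN' n (le_of_max_le_right hn))⟩
  | mul_X p i hp =>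
    obtain ⟨N, hN⟩ := hp
    exact ⟨max N (i + 1), fun n hn => mul_mem (hN n (le_of_max_le_left hn))
      (X_mem_range (Nat.lt_of_succ_le (le_of_max_le_right hn)))⟩

/-! ### Decomposable tensors as determinants -/

/-- The alternating map `(m_a) ↦ det (m_a(x_j))`, where `b_n` stands for the polynomial `t ^ n`. -/
noncomputable def altMulti (s : ℕ) : M [⋀^Fin s]→ₗ[ℚ] Br s :=
  ({ (Matrix.detRowAlternating (n := Fin s) (R := Br s)).toMultilinearMap.restrictScalars ℚ with
      map_eq_zero_of_eq' := fun v _ _ h hij =>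
        (Matrix.detRowAlternating (n := Fin s) (R := Br s)).map_eq_zero_of_eq v h hij } :
    (Fin s → Br s) [⋀^Fin s]→ₗ[ℚ] Br s).compLinearMap
    (Finsupp.linearCombination ℚ fun (n : ℕ) (j : Fin s) => (MvPolynomial.X j : Br s) ^ n)

/-- The linear map with `m₁ ∧ ⋯ ∧ m_s ↦ det (m_a(x_j))`. -/
noncomputable def altMap (s : ℕ) : ⋀[ℚ]^s M →ₗ[ℚ] Br s :=
  exteriorPower.alternatingMapLinearEquiv (altMulti s)

theorem altMap_ιMulti {s : ℕ} (m : Fin s → M) :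
    altMap s (exteriorPower.ιMulti ℚ s m) =
      (Matrix.of fun a => Finsupp.linearCombination ℚ
        (fun (n : ℕ) (j : Fin s) => (MvPolynomial.X j : Br s) ^ n) (m a)).det := by
  rw [altMap, exteriorPower.alternatingMapLinearEquiv_apply_ιMulti]
  rfl

theorem altMap_wedge {s : ℕ} (l : Par s) : altMap s (wedge l) = alt (expo l) := by
  rw [wedge, altMap_ιMulti, alt]
  congr 2
  ext1 a
  simp [b, expo]

/-- On the Schur basis this is the bialternant formula; the determinant on the right takes
Vandermonde values (`eval_det_cofac`). -/
theorem altMap_phi {s : ℕ} (p : Br s) :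
    altMap s (phi s p) = toSymm s p * (Matrix.of (cofac s)).det := by
  have h1 : (altMap s).comp (phi s) =
      (LinearMap.mulRight ℚ (Matrix.of (cofac s)).det).comp (toSymm s).toLinearMap := by
    apply (schurBasis s).ext
    intro l
    rw [schurBasis, Module.Basis.mk_apply]
    simp only [LinearMap.comp_apply, phi_schurDet, altMap_wedge, LinearMap.mulRight_apply,
      AlgHom.toLinearMap_apply]
    rw [schurDet_eq_hDet, toSymm_hDet]
  exact congrArg (fun φ : Br s →ₗ[ℚ] Br s => φ p) h1

theorem phi_surjective (s : ℕ) : Function.Surjective (phi s) := by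
  rw [← LinearMap.range_eq_top, eq_top_iff,
    ← exteriorPower.ιMulti_family_span_of_span ℚ (n := s) (v := b) (by
      rw [← (Finsupp.basisSingleOne (R := ℚ) (ι := ℕ)).span_eq]
      congr 2),
    Submodule.span_le]
  rintro _ ⟨S, rfl⟩
  obtain ⟨l, hl⟩ := exists_expo (fun i => Set.powersetCard.ofFinEmbEquiv.symm S i)
    (Set.powersetCard.ofFinEmbEquiv.symm S).strictMono
  refine ⟨schurDet l, ?_⟩
  rw [phi_schurDet, wedge, exteriorPower.ιMulti_family]
  congr 1
  funext k
  have := congrFun hl k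
  simp only [expo] at this
  rw [this, Function.comp_apply]

theorem altMap_injective (s : ℕ) : Function.Injective (altMap s) := by
  rw [← LinearMap.ker_eq_bot, LinearMap.ker_eq_bot']
  intro x hx
  obtain ⟨p, rfl⟩ := phi_surjective s x
  rw [altMap_phi] at hx
  have h1 := (mul_eq_zero.1 hx).resolve_right (det_cofac_ne_zero s)
  rw [(map_eq_zero_iff _ (toSymm_injective s)).1 h1, map_zero]

/-- The bialternant formula for the empty partition, whose Schur determinant is `1`. -/
theorem eval_det_cofac {s : ℕ} (y : Fin s → ℚ) :
    MvPolynomial.eval y (Matrix.of (cofac s)).det = (Matrix.vandermonde y).det := by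
  have h1 := toSymm_hDet (r := s) (fun a => (a : ℕ))
  rw [hDet_id, map_one, one_mul] at h1
  rw [h1, alt, RingHom.map_det, ← Matrix.det_transpose]
  congr 1
  ext i j
  simp [Matrix.vandermonde_apply]

/-- The value at `t` of the polynomial corresponding to `m ∈ M`. -/
noncomputable def evalM (t : ℚ) : M →ₗ[ℚ] ℚ := Finsupp.linearCombination ℚ fun n => t ^ n

theorem exists_evalM_eq (q : Polynomial ℚ) : ∃ m : M, ∀ t, evalM t m = q.eval t := by
  induction q using Polynomial.induction_on' with
  | add p q hp hq =>
    obtain ⟨m, hm⟩ := hp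
    obtain ⟨m', hm'⟩ := hq
    exact ⟨m + m', fun t => by rw [map_add, hm, hm', Polynomial.eval_add]⟩
  | monomial n a => exact ⟨Finsupp.single n a, fun t => by simp [evalM]⟩

theorem eval_altMap_ιMulti {s : ℕ} (m : Fin s → M) (y : Fin s → ℚ) :
    MvPolynomial.eval y (altMap s (exteriorPower.ιMulti ℚ s m)) =
      (Matrix.of fun i j => evalM (y j) (m i)).det := by
  rw [altMap_ιMulti, RingHom.map_det]
  congr 1
  ext i j
  simp [evalM, Finsupp.linearCombination_apply, Finsupp.sum]

theorem eval_altMap_phi {s : ℕ} (p : Br s) (y : Fin s → ℚ) :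
    MvPolynomial.eval y (altMap s (phi s p)) = alternant (incl s p) y := by
  rw [altMap_phi, map_mul, eval_det_cofac, alternant, aeval_pw_incl]

theorem phi_mem_cone_iff {s : ℕ} (p : Br s) :
    phi s p ∈ cone s ↔ ∃ m : Fin s → M, ∀ y : Fin s → ℚ,
      alternant (incl s p) y = (Matrix.of fun i j => evalM (y j) (m i)).det := by
  constructor
  · rintro ⟨m, hm⟩
    exact ⟨m, fun y => by rw [← eval_altMap_phi, ← hm, eval_altMap_ιMulti]⟩
  · rintro ⟨m, hm⟩
    refine ⟨m, altMap_injective s (MvPolynomial.funext fun y => ?_)⟩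
    rw [eval_altMap_ιMulti, eval_altMap_phi, hm]

/-- The alternant is a polynomial in all its points; freezing all but one leaves a polynomial in
`t`. These become the factors of the decomposable tensor. -/
theorem exists_evalM_eq_alternant {s : ℕ} (p : Br s) (y : Fin s → ℚ) (i : Fin s) :
    ∃ m : M, ∀ t, evalM t m = alternant (incl s p) (Function.update y i t) := by
  obtain ⟨m, hm⟩ := exists_evalM_eq (MvPolynomial.aeval
    (Function.update (fun j => Polynomial.C (y j)) i Polynomial.X) (altMap s (phi s p)))
  refine ⟨m, fun t => ?_⟩
  rw [hm, ← eval_altMap_phi]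
  have h1 : (Polynomial.aeval t).comp (MvPolynomial.aeval
      (Function.update (fun j => Polynomial.C (y j)) i Polynomial.X)) =
      (MvPolynomial.aeval (Function.update y i t) : Br s →ₐ[ℚ] ℚ) := by
    ext j
    by_cases hj : j = i
    · subst hj; simp
    · simp [hj]
  have h2 := congrArg (fun φ : Br s →ₐ[ℚ] ℚ => φ (altMap s (phi s p))) h1
  simpa using h2

/-! ### Separation by points -/

theorem mvPolynomial_eq_zero_of_eval {n : ℕ} {P Q : MvPolynomial (Fin n) ℚ} (hQ : Q ≠ 0)
    (h : ∀ y, MvPolynomial.eval y Q ≠ 0 → MvPolynomial.eval y P = 0) : P = 0 := by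
  refine (mul_eq_zero.1 (MvPolynomial.funext fun y => ?_ : P * Q = 0)).resolve_right hQ
  rw [map_mul, map_zero]
  by_cases hy : MvPolynomial.eval y Q = 0
  · rw [hy, mul_zero]
  · rw [h y hy, zero_mul]

theorem eq_zero_of_aeval_pw {n : ℕ} {τ : B} (hτ : τ ∈ (incl n).range) (G : Finset ℚ)
    (h : ∀ y : Fin n → ℚ, Function.Injective y → (∀ k, y k ∉ G) →
      (MvPolynomial.aeval (pw Finset.univ y) : B →ₐ[ℚ] ℚ) τ = 0) : τ = 0 := by
  obtain ⟨p, rfl⟩ := hτ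
  -- Where this polynomial is nonzero, the points are distinct and avoid `G`.
  have hQ : (Matrix.of (cofac n)).det *
      ∏ k, ∏ g ∈ G, ((MvPolynomial.X k : Br n) - MvPolynomial.C g) ≠ 0 := by
    refine mul_ne_zero (det_cofac_ne_zero n) (Finset.prod_ne_zero_iff.2 fun k _ =>
      Finset.prod_ne_zero_iff.2 fun g _ h0 => ?_)
    have := congrArg (MvPolynomial.eval fun _ => g + 1) h0
    simp at this
  have h1 : toSymm n p = 0 := by
    refine mvPolynomial_eq_zero_of_eval hQ fun y hy => ?_
    rw [map_mul, eval_det_cofac, map_prod] at hy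
    rw [← aeval_pw_incl]
    refine h y (Matrix.det_vandermonde_ne_zero_iff.1 (left_ne_zero_of_mul hy)) fun k hk => ?_
    have h2 := Finset.prod_ne_zero_iff.1 (right_ne_zero_of_mul hy) k (Finset.mem_univ k)
    rw [map_prod] at h2
    have h3 := Finset.prod_ne_zero_iff.1 h2 (y k) hk
    simp at h3
  rw [(map_eq_zero_iff _ (toSymm_injective n)).1 h1]
  exact map_zero (incl n)

/-- An element of `B ⊗ B` vanishes if it vanishes at sufficiently many points. -/
theorem exists_eq_zero_of_productMap (T : B ⊗[ℚ] B) : ∃ N, ∀ n ≥ N,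
    (∀ (y : Fin n → ℚ) (y' : Fin (n + 2) → ℚ), Function.Injective y → Function.Injective y' →
      (∀ i k, y i ≠ y' k) →
      Algebra.TensorProduct.productMap (MvPolynomial.aeval (pw Finset.univ y) : B →ₐ[ℚ] ℚ)
        (MvPolynomial.aeval (pw Finset.univ y') : B →ₐ[ℚ] ℚ) T = 0) → T = 0 := by
  classical
  obtain ⟨c, rfl⟩ := TensorProduct.eq_repr_basis_right (MvPolynomial.basisMonomials ℕ ℚ) T
  set β := MvPolynomial.basisMonomials ℕ ℚ with hβ
  have hev : ∀ τ : B, ∀ᶠ n in Filter.atTop, τ ∈ (incl n).range :=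
    fun τ => Filter.eventually_atTop.2 (exists_forall_mem_range τ)
  -- The finitely many tensor factors of `T` lie in a common `ℚ[e₁, …, e_n]`, where `n` points
  -- separate; the two factors are then tested one after the other.
  obtain ⟨N, hN⟩ := Filter.eventually_atTop.1
    (((Filter.eventually_all_finset c.support).2 fun i _ => hev (c i)).and
      ((Filter.eventually_all_finset c.support).2 fun i _ => hev (β i)))
  refine ⟨N, fun n hn h => ?_⟩
  have hc : ∀ i ∈ c.support, c i = 0 := by
    intro i hi
    refine eq_zero_of_aeval_pw ((hN n hn).1 i hi) ∅ fun y hy _ => ?_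
    have h1 : ∑ i ∈ c.support, (MvPolynomial.aeval (pw Finset.univ y) : B →ₐ[ℚ] ℚ) (c i) • β i
        = 0 := by
      refine eq_zero_of_aeval_pw (n := n + 2) (sum_mem fun j hj => (incl (n + 2)).range.smul_mem
        ((hN (n + 2) (by omega)).2 j hj) _) (Finset.univ.image y) fun y' hy' hG => ?_
      rw [← h y y' hy hy' fun i k hik => hG k (Finset.mem_image.2 ⟨i, Finset.mem_univ i, hik⟩)]
      simp only [Finsupp.sum, map_sum, Algebra.TensorProduct.productMap_apply_tmul, map_smul,
        smul_eq_mul]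
    exact linearIndependent_iff'.1 β.linearIndependent _ _ h1 i hi
  exact Finset.sum_eq_zero fun i hi => by
    rw [hc i hi]
    exact TensorProduct.zero_tmul _ _

/-! ### The main theorem -/

theorem pw_cons {n : ℕ} (u : ℚ) (y : Fin n → ℚ) (i : ℕ) :
    pw Finset.univ (Fin.cons u y : Fin (n + 1) → ℚ) i = pt u i + pw Finset.univ y i := by
  simp [pw, pt, Fin.sum_univ_succ, add_div]

theorem hirotaKP_of_correspondsToCone {τ : B} (h : CorrespondsToCone τ) : HirotaKP τ := by
  obtain ⟨r, hr⟩ := h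
  obtain ⟨N, hN⟩ := exists_eq_zero_of_productMap (residue (laurentTensor (GamStar τ) (Gam τ)))
  refine hN (max N r) (le_max_left _ _) fun z y' hz hy' hzy => ?_
  obtain ⟨p, hp, hc⟩ := hr (max N r + 1) ((le_max_right _ _).trans (Nat.le_succ _))
  obtain ⟨m, hm⟩ := (phi_mem_cone_iff p).1 hc
  rw [hp] at hm
  -- With `s = max N r + 1`, the head of `y'` plays the role of the exchanged point: `y₀` without it
  -- is `z`, and the tail of `y'` together with it is `y'`.
  set y₀ : Fin (max N r + 1) → ℚ := Fin.cons (y' 0) z with hy₀def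
  set y := Fin.tail y' with hydef
  have hy₀ : Function.Injective y₀ := by
    rw [hy₀def, Fin.cons_injective_iff]
    exact ⟨fun ⟨i, hi⟩ => hzy i 0 hi, hz⟩
  have hy : Function.Injective y := hy'.comp (Fin.succ_injective _)
  have hu : ∀ k, y₀ 0 ≠ y k := fun k hk => Fin.succ_ne_zero k (hy' hk).symm
  have h1 := alternant_exchange τ hy₀ hy 0 hu
  simp only [hm] at h1
  rw [det_exchange (fun i t => evalM t (m i)), sub_self] at h1
  have h2 : pw (Finset.univ.erase 0) y₀ = pw Finset.univ z := by
    funext i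
    have h3 := pw_univ y₀ 0 i
    rw [hy₀def, pw_cons, Fin.cons_zero] at h3
    linarith
  have h3 : pw Finset.univ (fun o : Option (Fin (max N r + 1)) => o.elim (y₀ 0) y) =
      pw Finset.univ y' := by
    funext i
    rw [pw_option, ← Fin.cons_self_tail y', pw_cons]
    rfl
  rw [h2, h3] at h1
  refine (mul_eq_zero.1 h1.symm).resolve_left (mul_ne_zero (mul_ne_zero
    (Matrix.det_vandermonde_ne_zero_iff.2 hy₀) (Matrix.det_vandermonde_ne_zero_iff.2 hy))
    (div_ne_zero (Finset.prod_ne_zero_iff.2 fun k _ => sub_ne_zero.2 (hu k))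
      (Finset.prod_ne_zero_iff.2 fun b hb => sub_ne_zero.2 fun h => ?_)))
  exact Finset.ne_of_mem_erase hb (hy₀ h).symm

/-- Positivity of `s` is essential: in degree `0` only `1` is decomposable, while here zero must be
decomposable and the scalar `A(y₀)` must be absorbed into a factor. -/
theorem phi_mem_cone_of_hirotaKP {s : ℕ} (hs : 0 < s) {p : Br s} (h : HirotaKP (incl s p)) :
    phi s p ∈ cone s := by
  rw [phi_mem_cone_iff]
  have : Nonempty (Fin s) := ⟨⟨0, hs⟩⟩
  by_cases h0 : ∀ y : Fin s → ℚ, alternant (incl s p) y = 0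
  · refine ⟨0, fun y => ?_⟩
    rw [h0]
    simp only [Pi.zero_apply, map_zero]
    exact Matrix.det_zero.symm
  push Not at h0
  obtain ⟨y₀, hy₀⟩ := h0
  set c := alternant (incl s p) y₀ with hc
  have hy₀i : Function.Injective y₀ := by
    by_contra hn
    exact hy₀ (alternant_of_not_injective _ hn)
  have key := eq_det_of_exchange hy₀ (fun y hy => alternant_of_not_injective (incl s p) hy)
    (fun y σ => alternant_comp_perm (incl s p) y σ) (fun y hy a ha => by
      have h1 := alternant_exchange (incl s p) hy₀i hy a ha
      rw [show residue (laurentTensor (GamStar (incl s p)) (Gam (incl s p))) = 0 from h, map_zero,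
        mul_zero] at h1
      exact sub_eq_zero.1 h1)
  choose m hm using exists_evalM_eq_alternant p y₀
  -- Every row is divided by `c`, and the overall factor `c` goes into row `0`.
  let v : Fin s → ℚ := fun i => if i = ⟨0, hs⟩ then c else 1
  refine ⟨fun i => (v i * c⁻¹) • m i, fun y => ?_⟩
  have h1 : (Matrix.of fun i j => evalM (y j) ((v i * c⁻¹) • m i)) =
      Matrix.of fun i j => v i * (Matrix.of fun i j =>
        alternant (incl s p) (Function.update y₀ i (y j)) / c) i j := by
    ext i j
    simp only [Matrix.of_apply, map_smul, hm, smul_eq_mul]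
    ring
  rw [h1, Matrix.det_mul_column, key y]
  congr 1
  simpa [v] using hc.symm

end KP

theorem mainTheorem5 (τ : KP.B) : KP.CorrespondsToCone τ ↔ KP.HirotaKP τ := by
  refine ⟨KP.hirotaKP_of_correspondsToCone, fun h => ?_⟩
  obtain ⟨N, hN⟩ := KP.exists_forall_mem_range τ
  -- The extra `1` forces `s > 0`.
  refine ⟨N + 1, fun s hs => ?_⟩
  obtain ⟨p, hp⟩ := hN s (by omega)
  have hp : KP.incl s p = τ := hp
  exact ⟨p, hp, KP.phi_mem_cone_of_hirotaKP (by omega) (hp ▸ h)⟩
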